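/- Let $d\ge 1$. Let $(\xi(x))_{x\in\mathbb Z^d}$ be i.i.d. real random variables on a probability space $(\Omega,\mathcal F,\mathbb P)$ with $0<\mathbb E(\xi(0)^2)<\infty$. Let $V\in C^2(\mathbb R)$ be even and suppose that there are constants $A>0$, $B\in\mathbb R$, $C_2>0$ with $V(s)\ge As^2-B$ and $V''(s)\le C_2$ for all $s\in\mathbb R$. For a finite set $\Lambda\subset\mathbb Z^d$ put $\partial\Lambda=\{x\notin\Lambda:\ \|x-y\|_1=1\text{ for some }y\in\Lambda\}$, and for $\psi\in\mathbb R^{\mathbb Z^d}$ and $\phi\in\mathbb R^\Lambda$ let $$H_\Lambda^\psi[\xi](\phi)=\frac12\sum_{\substack{x,y\in\Lambda\\ \|x-y\|_1=1}}V(\phi(x)-\phi(y))+\sum_{\substack{x\in\Lambda,\ y\in\partial\Lambda\\ \|x-y\|_1=1}}V(\phi(x)-\psi(y))+\frac12\sum_{x\in\Lambda}\xi(x)\phi(x)$$ (model A; the first sum is over ordered pairs). For $u\in\mathbb R^d$ let $\psi_u(x)=x\cdot u$, let $\Lambda_N=[-N,N]^d\cap\mathbb Z^d$, and let $$\sigma_{\Lambda_N}[\xi](u)=-\frac1{|\Lambda_N|}\log\int_{\mathbb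 R^{\Lambda_N}}\exp\bigl(-H_{\Lambda_N}^{\psi_u}[\xi](\phi)\bigr)\,d\phi$$ be the finite-volume surface tension with tilt $u$. Suppose that $d\in\{1,2\}$, or that $d\ge3$ and $\mathbb E(\xi(0))\ne0$. Then the infinite-volume surface tension does not exist: for every $u\in\mathbb R^d$ and for $\mathbb P$-almost every $\xi$, the sequence $\sigma_{\Lambda_N}[\xi](u)$ has no finite limit as $N\to\infty$. -/

import Mathlib

open Filter Topology MeasureTheory ProbabilityTheory

noncomputable section

namespace RandomInterface

/-- The `ℓ¹` distance on `ℤ^d`; `x` and `y` are nearest neighbours iff it equals `1`. -/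
def l1dist {d : ℕ} (x y : Fin d → ℤ) : ℤ := ∑ i, |x i - y i|

/-- The outer boundary `∂Λ = {x ∉ Λ : ‖x - y‖₁ = 1 for some y ∈ Λ}` of a finite set, as a finite
set. The first line only bounds the search region; see `mem_boundary`. -/
def boundary {d : ℕ} (Λ : Finset (Fin d → ℤ)) : Finset (Fin d → ℤ) :=
  (Λ.biUnion fun y => Finset.Icc (fun i => y i - 1) (fun i => y i + 1)).filter
    fun x => x ∉ Λ ∧ ∃ y ∈ Λ, l1dist x y = 1

theorem mem_boundary {d : ℕ} (Λ : Finset (Fin d → ℤ)) (x : Fin d → ℤ) :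
    x ∈ boundary Λ ↔ x ∉ Λ ∧ ∃ y ∈ Λ, l1dist x y = 1 := by
  unfold boundary
  rw [Finset.mem_filter, and_iff_right_iff_imp]
  rintro ⟨-, y, hy, hxy⟩
  have h : ∀ i, |x i - y i| ≤ 1 := fun i => by
    rw [← hxy]
    exact Finset.single_le_sum (f := fun i => |x i - y i|)
      (fun j _ => abs_nonneg _) (Finset.mem_univ i)
  simp only [Finset.mem_biUnion, Finset.mem_Icc, Pi.le_def]
  refine ⟨y, hy, fun i => ?_, fun i => ?_⟩
  · have := (abs_le.mp (h i)).1
    linarith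
  · have := (abs_le.mp (h i)).2
    linarith

/-- The hypercube `Λ_N = [-N, N]^d ∩ ℤ^d`. -/
def box (d N : ℕ) : Finset (Fin d → ℤ) :=
  Finset.Icc (fun _ => -(N : ℤ)) (fun _ => (N : ℤ))

/-- The finite-volume Hamiltonian `H_Λ^ψ[ξ](φ)` of model A: pair potential `V`, disorder `ξ`,
boundary condition `ψ`, heights `φ` on `Λ`. -/
def hamiltonian {d : ℕ} (V : ℝ → ℝ) (ξ : (Fin d → ℤ) → ℝ) (Λ : Finset (Fin d → ℤ))
    (ψ : (Fin d → ℤ) → ℝ) (φ : Λ → ℝ) : ℝ :=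
  (1 / 2 : ℝ) * (∑ x : Λ, ∑ y : Λ,
      if l1dist (x : Fin d → ℤ) (y : Fin d → ℤ) = 1 then V (φ x - φ y) else 0)
    + (∑ x : Λ, ∑ y ∈ boundary Λ,
      if l1dist (x : Fin d → ℤ) y = 1 then V (φ x - ψ y) else 0)
    + (1 / 2 : ℝ) * ∑ x : Λ, ξ x * φ x

/-- The partition function `Z_Λ^ψ[ξ] = ∫_{ℝ^Λ} exp(-H_Λ^ψ[ξ](φ)) dφ_Λ`. -/
def partitionFunction {d : ℕ} (V : ℝ → ℝ) (ξ : (Fin d → ℤ) → ℝ) (Λ : Finset (Fin d → ℤ))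
    (ψ : (Fin d → ℤ) → ℝ) : ℝ :=
  ∫ φ : Λ → ℝ, Real.exp (-hamiltonian V ξ Λ ψ φ)

/-- The boundary condition `ψ_u(x) = x · u` of tilt `u`. -/
def tilted {d : ℕ} (u : Fin d → ℝ) (x : Fin d → ℤ) : ℝ := ∑ i, (x i : ℝ) * u i

/-- The finite-volume surface tension `σ_{Λ_N}[ξ](u) = -|Λ_N|⁻¹ log Z_{Λ_N}^{ψ_u}[ξ]`. -/
def finiteVolumeSurfaceTension {d : ℕ} (V : ℝ → ℝ) (ξ : (Fin d → ℤ) → ℝ) (N : ℕ)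
    (u : Fin d → ℝ) : ℝ :=
  -(1 / ((box d N).card : ℝ)) * Real.log (partitionFunction V ξ (box d N) (tilted u))

/-- `σ` is the (infinite-volume) surface tension at tilt `u` for the disorder `ξ`:
`σ = lim_{N → ∞} σ_{Λ_N}[ξ](u)`. -/
def IsSurfaceTension {d : ℕ} (V : ℝ → ℝ) (ξ : (Fin d → ℤ) → ℝ) (u : Fin d → ℝ) (σ : ℝ) : Prop :=
  Tendsto (fun N : ℕ => finiteVolumeSurfaceTension V ξ N u) atTop (𝓝 σ)

end RandomInterface

end

/-!
The finite-volume surface tension is bounded above by evaluating the partition function near one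
trial configuration, and a good choice of trial configuration shows that it is not bounded below.

Since `V'' ≤ C₂` and `V` is even, `V s ≤ V 0 + C₂ s² / 2`. On the unit cube centred at a
configuration `c` equal to `ψ_u` off `Λ_N` the Hamiltonian is therefore at most a constant per site
plus `C₂` times the Dirichlet energy of `c` plus `½ ∑ ξ c + ¼ ∑ |ξ|`, and `-log Z` obeys the same
bound (`card_mul_surfaceTension_le`). The lower bound on `V` enters only to make the Boltzmann
weight integrable (`integrable_exp_neg_hamiltonian`), without which `Z` would be the junk value `0`.
With `c = ψ_u + h` it remains to choose `h`, vanishing off `Λ_N`, so that `-∑ ξ h` exceeds any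
multiple of `|Λ_N|`, of the energy of `h` and of the fluctuations of `∑ ξ ψ_u`.

* If `m = 𝔼 ξ ≠ 0`, in any dimension, `h = -m g` with `g` a Lipschitz bump of height of order `N`:
  bounded energy per site, gain of order `m² N` per site
  (`measure_surfaceTension_ge_of_mean_ne_zero`).
* If `m = 0` and `d ≤ 2`, `h = -T (k * ξ)` with a finitely supported kernel `k`, `k 0 = 1`. The
  gain is `T ∑ ξ²` up to an off-diagonal sum that is small in `L²`, while the energy has mean
  proportional to `T²` times the Dirichlet energy of `k`. As points of `ℤ` and `ℤ²` have zero
  capacity, the latter can be made small compared with `1 / T` for `T` large (`exists_kernel`).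
  Only the diagonal sum has to be bounded below, by Chebyshev's inequality for `min (ξ²) 1`; all the
  errors are handled by Markov's inequality, so that two moments of `ξ` suffice
  (`measure_surfaceTension_ge_of_mean_eq_zero`).

In both cases, for each `K`, the surface tension in some box is below `-K` with probability
arbitrarily close to one, which excludes a finite limit (`ae_not_isSurfaceTension`).
-/

noncomputable section

namespace RandomInterface

/-! ### Lattice geometry and discrete Dirichlet energy -/

/-- The `2d` unit vectors `±eᵢ` of `ℤ^d`: the neighbours of `x` are the points `x + v`. -/
def unitSteps (d : ℕ) : Finset (Fin d → ℤ) :=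
  (Finset.Icc (fun _ => -1) (fun _ => 1)).filter fun v => ∑ i, |v i| = 1

theorem mem_unitSteps {d : ℕ} {v : Fin d → ℤ} : v ∈ unitSteps d ↔ ∑ i, |v i| = 1 := by
  unfold unitSteps
  rw [Finset.mem_filter, and_iff_right_iff_imp]
  intro hv
  have h : ∀ i, |v i| ≤ 1 := fun i => by
    rw [← hv]
    exact Finset.single_le_sum (f := fun i => |v i|) (fun j _ => abs_nonneg _) (Finset.mem_univ i)
  rw [Finset.mem_Icc]
  exact ⟨fun i => (abs_le.mp (h i)).1, fun i => (abs_le.mp (h i)).2⟩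

/-- The bound `3^d` is cruder than the true cardinality `2d`, but any constant will do. -/
theorem card_unitSteps_le (d : ℕ) : ((unitSteps d).card : ℝ) ≤ 3 ^ d := by
  have h : (unitSteps d).card ≤ 3 ^ d := by
    refine (Finset.card_filter_le _ _).trans ?_
    rw [Pi.card_Icc]
    simp
  exact_mod_cast h

theorem norm_le_one_of_mem_unitSteps {d : ℕ} {v : Fin d → ℤ} (hv : v ∈ unitSteps d) :
    ‖v‖ ≤ 1 := by
  rw [pi_norm_le_iff_of_nonneg zero_le_one]
  intro i
  rw [mem_unitSteps] at hv
  have h : |v i| ≤ 1 := by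
    rw [← hv]
    exact Finset.single_le_sum (f := fun i => |v i|) (fun j _ => abs_nonneg _) (Finset.mem_univ i)
  rw [Int.norm_eq_abs]
  exact_mod_cast h

theorem abs_norm_add_sub_norm_le {d : ℕ} (x : Fin d → ℤ) {v : Fin d → ℤ} (hv : v ∈ unitSteps d) :
    |‖x + v‖ - ‖x‖| ≤ 1 := by
  have := abs_norm_sub_norm_le (x + v) x
  rw [add_sub_cancel_left] at this
  exact this.trans (norm_le_one_of_mem_unitSteps hv)

theorem mem_box {d N : ℕ} {x : Fin d → ℤ} : x ∈ box d N ↔ ‖x‖ ≤ N := by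
  rw [box, Finset.mem_Icc, pi_norm_le_iff_of_nonneg (Nat.cast_nonneg N), Pi.le_def, Pi.le_def,
    ← forall_and]
  refine forall_congr' fun i => ?_
  rw [← abs_le, Int.norm_eq_abs]
  exact_mod_cast Iff.rfl

theorem card_box (d N : ℕ) : (box d N).card = (2 * N + 1) ^ d := by
  rw [box, Pi.card_Icc]
  have : ((N : ℤ) + 1 - -(N : ℤ)).toNat = 2 * N + 1 := by omega
  simp only [this, Int.card_Icc, Finset.prod_const, Finset.card_univ, Fintype.card_fin]

theorem card_box_pos (d N : ℕ) : (0 : ℝ) < (box d N).card := by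
  rw [card_box]
  positivity

/-- All neighbours of a site of `Λ` lie in `Λ` or in its boundary. -/
theorem sum_neighbours {d : ℕ} (Λ : Finset (Fin d → ℤ)) {x : Fin d → ℤ} (hx : x ∈ Λ)
    (F : (Fin d → ℤ) → ℝ) :
    (∑ y ∈ Λ, if l1dist x y = 1 then F y else 0)
      + (∑ y ∈ boundary Λ, if l1dist x y = 1 then F y else 0)
      = ∑ v ∈ unitSteps d, F (x + v) := by
  have hdisj : Disjoint Λ (boundary Λ) := by
    rw [Finset.disjoint_right]
    intro y hy
    exact ((mem_boundary Λ y).1 hy).1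
  rw [← Finset.sum_union hdisj, ← Finset.sum_filter]
  have hdist : ∀ v : Fin d → ℤ, l1dist x (x + v) = ∑ i, |v i| := fun v => by
    unfold l1dist
    exact Finset.sum_congr rfl fun i _ => by rw [Pi.add_apply, sub_add_cancel_left, abs_neg]
  refine Finset.sum_nbij' (fun y => y - x) (fun v => x + v) ?_ ?_ ?_ ?_ ?_
  · intro y hy
    rw [mem_unitSteps, ← hdist, add_sub_cancel]
    exact (Finset.mem_filter.1 hy).2
  · intro v hv
    rw [mem_unitSteps, ← hdist] at hv
    refine Finset.mem_filter.2 ⟨?_, hv⟩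
    rw [Finset.mem_union, mem_boundary]
    by_cases h : x + v ∈ Λ
    · exact Or.inl h
    · refine Or.inr ⟨h, x, hx, ?_⟩
      rw [← hv]
      unfold l1dist
      exact Finset.sum_congr rfl fun i _ => abs_sub_comm _ _
  · intro y _
    exact add_sub_cancel x y
  · intro v _
    exact add_sub_cancel_left x v
  · intro y _
    rw [add_sub_cancel]

/-- The Dirichlet energy of `c` over the bonds that touch `Λ`. Bonds inside `Λ` count twice. -/
def dirichlet {d : ℕ} (Λ : Finset (Fin d → ℤ)) (c : (Fin d → ℤ) → ℝ) : ℝ :=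
  ∑ x ∈ Λ, ∑ v ∈ unitSteps d, (c (x + v) - c x) ^ 2

theorem dirichlet_nonneg {d : ℕ} (Λ : Finset (Fin d → ℤ)) (c : (Fin d → ℤ) → ℝ) :
    0 ≤ dirichlet Λ c :=
  Finset.sum_nonneg fun _ _ => Finset.sum_nonneg fun _ _ => sq_nonneg _

theorem dirichlet_add_le {d : ℕ} (Λ : Finset (Fin d → ℤ)) (b c : (Fin d → ℤ) → ℝ) :
    dirichlet Λ (fun x => b x + c x) ≤ 2 * dirichlet Λ b + 2 * dirichlet Λ c := by
  unfold dirichlet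
  simp only [Finset.mul_sum, ← Finset.sum_add_distrib]
  refine Finset.sum_le_sum fun x _ => Finset.sum_le_sum fun v _ => ?_
  nlinarith [sq_nonneg ((b (x + v) - b x) - (c (x + v) - c x))]

theorem dirichlet_le_of_lipschitz {d : ℕ} (Λ : Finset (Fin d → ℤ)) (c : (Fin d → ℤ) → ℝ) (L : ℝ)
    (h : ∀ x, ∀ v ∈ unitSteps d, |c (x + v) - c x| ≤ L) :
    dirichlet Λ c ≤ Λ.card * (3 ^ d * L ^ 2) := by
  unfold dirichlet
  rw [← nsmul_eq_mul]
  refine Finset.sum_le_card_nsmul _ _ _ fun x _ => ?_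
  calc ∑ v ∈ unitSteps d, (c (x + v) - c x) ^ 2
      ≤ (unitSteps d).card • L ^ 2 :=
        Finset.sum_le_card_nsmul _ _ _ fun v hv => sq_le_sq' (abs_le.1 (h x v hv)).1
          (abs_le.1 (h x v hv)).2
    _ ≤ 3 ^ d * L ^ 2 := by
        rw [nsmul_eq_mul]
        exact mul_le_mul_of_nonneg_right (card_unitSteps_le d) (sq_nonneg L)

theorem dirichlet_comp_sub {d : ℕ} (Λ : Finset (Fin d → ℤ)) (c : (Fin d → ℤ) → ℝ)
    (y : Fin d → ℤ) :
    dirichlet Λ (fun x => c (x - y)) = dirichlet (Λ.image fun x => x - y) c := by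
  unfold dirichlet
  rw [Finset.sum_image (fun a _ b _ h => sub_left_injective h)]
  exact Finset.sum_congr rfl fun x _ => Finset.sum_congr rfl fun v _ => by
    simp only [add_sub_right_comm]

/-- The configuration equal to `φ` on `Λ` and to `ψ` off `Λ`. -/
def glue {d : ℕ} (Λ : Finset (Fin d → ℤ)) (ψ : (Fin d → ℤ) → ℝ) (φ : Λ → ℝ)
    (x : Fin d → ℤ) : ℝ :=
  if h : x ∈ Λ then φ ⟨x, h⟩ else ψ x

theorem glue_coe {d : ℕ} (Λ : Finset (Fin d → ℤ)) (ψ : (Fin d → ℤ) → ℝ) (φ : Λ → ℝ) (x : Λ) :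
    glue Λ ψ φ x = φ x := by
  rw [glue, dif_pos x.2]

theorem glue_of_notMem {d : ℕ} (Λ : Finset (Fin d → ℤ)) (ψ : (Fin d → ℤ) → ℝ) (φ : Λ → ℝ)
    {x : Fin d → ℤ} (hx : x ∉ Λ) : glue Λ ψ φ x = ψ x := by
  rw [glue, dif_neg hx]

theorem hamiltonian_eq_glue {d : ℕ} (V : ℝ → ℝ) (ξ : (Fin d → ℤ) → ℝ) (Λ : Finset (Fin d → ℤ))
    (ψ : (Fin d → ℤ) → ℝ) (φ : Λ → ℝ) :
    hamiltonian V ξ Λ ψ φ = (∑ x ∈ Λ, ((1 / 2 : ℝ) *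
        (∑ y ∈ Λ, if l1dist x y = 1 then V (glue Λ ψ φ x - glue Λ ψ φ y) else 0)
      + ∑ y ∈ boundary Λ, if l1dist x y = 1 then V (glue Λ ψ φ x - glue Λ ψ φ y) else 0))
      + (1 / 2 : ℝ) * ∑ x : Λ, ξ x * φ x := by
  rw [hamiltonian, Finset.sum_add_distrib, ← Finset.mul_sum]
  refine congrArg₂ _ (congrArg₂ _ (congrArg _ ?_) ?_) rfl
  · rw [← Finset.sum_coe_sort Λ]
    refine Finset.sum_congr rfl fun x _ => ?_
    rw [← Finset.sum_coe_sort Λ]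
    simp only [glue_coe]
  · rw [← Finset.sum_coe_sort Λ]
    refine Finset.sum_congr rfl fun x _ => Finset.sum_congr rfl fun y hy => ?_
    rw [glue_coe, glue_of_notMem _ _ _ ((mem_boundary Λ y).1 hy).1]

theorem hamiltonian_le {d : ℕ} {V : ℝ → ℝ} {a b : ℝ} (ha : 0 ≤ a) (hb : 0 ≤ b)
    (hV : ∀ s, V s ≤ a + b * s ^ 2) (ξ : (Fin d → ℤ) → ℝ) (Λ : Finset (Fin d → ℤ))
    (ψ : (Fin d → ℤ) → ℝ) (φ : Λ → ℝ) :
    hamiltonian V ξ Λ ψ φ ≤ Λ.card * (3 ^ d * a) + b * dirichlet Λ (glue Λ ψ φ)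
      + (1 / 2 : ℝ) * ∑ x : Λ, ξ x * φ x := by
  rw [hamiltonian_eq_glue]
  refine add_le_add_left ?_ _
  rw [dirichlet, Finset.mul_sum, ← nsmul_eq_mul, ← Finset.sum_const, ← Finset.sum_add_distrib]
  refine Finset.sum_le_sum fun x hx => ?_
  set c := glue Λ ψ φ
  have hF : ∀ y, 0 ≤ a + b * (c y - c x) ^ 2 := fun y => by positivity
  have hle : ∀ y, (if l1dist x y = 1 then V (c x - c y) else 0)
      ≤ if l1dist x y = 1 then a + b * (c y - c x) ^ 2 else 0 := fun y => by
    split_ifs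
    · rw [sub_sq_comm]
      exact hV _
    · exact le_rfl
  have h1 := Finset.sum_le_sum (s := Λ) fun y _ => hle y
  have h2 := Finset.sum_le_sum (s := boundary Λ) fun y _ => hle y
  have h3 : 0 ≤ ∑ y ∈ Λ, if l1dist x y = 1 then a + b * (c y - c x) ^ 2 else 0 :=
    Finset.sum_nonneg fun y _ => by
      split_ifs
      · exact hF y
      · exact le_rfl
  have h4 := sum_neighbours Λ hx fun y => a + b * (c y - c x) ^ 2
  rw [Finset.sum_add_distrib, Finset.sum_const, nsmul_eq_mul, ← Finset.mul_sum] at h4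
  have h5 := mul_le_mul_of_nonneg_right (card_unitSteps_le d) ha
  linarith

theorem le_hamiltonian {d : ℕ} {V : ℝ → ℝ} {a b : ℝ} (ha : 0 ≤ a) (hb : 0 ≤ b)
    (hV : ∀ s, b * s ^ 2 - a ≤ V s) (ξ : (Fin d → ℤ) → ℝ) (Λ : Finset (Fin d → ℤ))
    (ψ : (Fin d → ℤ) → ℝ) (φ : Λ → ℝ) :
    b / 2 * dirichlet Λ (glue Λ ψ φ) - Λ.card * (3 ^ d * a)
      + (1 / 2 : ℝ) * ∑ x : Λ, ξ x * φ x ≤ hamiltonian V ξ Λ ψ φ := by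
  rw [hamiltonian_eq_glue]
  refine add_le_add_left ?_ _
  rw [dirichlet, Finset.mul_sum, ← nsmul_eq_mul, ← Finset.sum_const, ← Finset.sum_sub_distrib]
  refine Finset.sum_le_sum fun x hx => ?_
  set c := glue Λ ψ φ
  have hle : ∀ y, (if l1dist x y = 1 then b * (c y - c x) ^ 2 else 0)
      - (if l1dist x y = 1 then a else 0) ≤ if l1dist x y = 1 then V (c x - c y) else 0 :=
    fun y => by
      split_ifs
      · rw [sub_sq_comm]
        exact hV _
      · simp
  have h1 := Finset.sum_le_sum (s := Λ) fun y _ => hle y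
  have h2 := Finset.sum_le_sum (s := boundary Λ) fun y _ => hle y
  rw [Finset.sum_sub_distrib] at h1 h2
  have hn : ∀ (s : Finset (Fin d → ℤ)) (F : (Fin d → ℤ) → ℝ), (∀ y, 0 ≤ F y) →
      0 ≤ ∑ y ∈ s, if l1dist x y = 1 then F y else 0 := fun s F hF =>
    Finset.sum_nonneg fun y _ => by
      split_ifs
      · exact hF y
      · exact le_rfl
  have h3 := hn Λ (fun _ => a) fun _ => ha
  have h4 := hn (boundary Λ) (fun y => b * (c y - c x) ^ 2) fun y => by positivity
  have h5 := sum_neighbours Λ hx fun y => b * (c y - c x) ^ 2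
  have h6 := sum_neighbours Λ hx fun _ => a
  rw [← Finset.mul_sum] at h5
  rw [Finset.sum_const, nsmul_eq_mul] at h6
  have h7 := mul_le_mul_of_nonneg_right (card_unitSteps_le d) ha
  linarith

/-! ### Integrability of the Boltzmann weight -/

/-- Discrete Poincaré inequality: from any site of the box the boundary is reached along the first
coordinate direction in at most `2N + 1` steps, each of which costs at most the square root of the
energy. -/
theorem abs_glue_box_le {d : ℕ} (i₀ : Fin d) (N : ℕ) (ψ : (Fin d → ℤ) → ℝ) (φ : box d N → ℝ)
    {x : Fin d → ℤ} (hx : x ∈ box d N) :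
    |glue (box d N) ψ φ x| ≤ (∑ y ∈ boundary (box d N), |ψ y|)
      + (2 * N + 1) * √(dirichlet (box d N) (glue (box d N) ψ φ)) := by
  set c := glue (box d N) ψ φ
  set M := ∑ y ∈ boundary (box d N), |ψ y|
  set Q := √(dirichlet (box d N) c)
  have hQ : 0 ≤ Q := Real.sqrt_nonneg _
  have he : Pi.single i₀ 1 ∈ unitSteps d := by
    rw [mem_unitSteps, Finset.sum_eq_single i₀]
    · simp
    · intro j _ hj
      simp [Pi.single_eq_of_ne hj]
    · simp
  have hstep : ∀ x ∈ box d N, |c x| ≤ |c (x + Pi.single i₀ 1)| + Q := fun x hx => by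
    have h1 : (c (x + Pi.single i₀ 1) - c x) ^ 2 ≤ dirichlet (box d N) c :=
      (Finset.single_le_sum (f := fun v => (c (x + v) - c x) ^ 2)
        (fun v _ => sq_nonneg _) he).trans
        (Finset.single_le_sum (f := fun x => ∑ v ∈ unitSteps d, (c (x + v) - c x) ^ 2)
        (fun x _ => Finset.sum_nonneg fun v _ => sq_nonneg _) hx)
    have h2 : |c (x + Pi.single i₀ 1) - c x| ≤ Q := Real.abs_le_sqrt h1
    have h3 := abs_sub_abs_le_abs_sub (c x) (c (x + Pi.single i₀ 1))
    rw [abs_sub_comm] at h3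
    linarith
  have hout : ∀ x ∈ box d N, x + Pi.single i₀ 1 ∉ box d N → |c (x + Pi.single i₀ 1)| ≤ M :=
    fun x hx h => by
      rw [show c (x + Pi.single i₀ 1) = ψ (x + Pi.single i₀ 1) from glue_of_notMem _ _ _ h]
      refine Finset.single_le_sum (f := fun y => |ψ y|) (fun y _ => abs_nonneg _) ?_
      rw [mem_boundary]
      refine ⟨h, x, hx, ?_⟩
      simpa [l1dist] using mem_unitSteps.1 he
  have key : ∀ n : ℕ, ∀ x ∈ box d N, (N : ℤ) - x i₀ ≤ n → |c x| ≤ M + (n + 1) * Q := by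
    intro n
    induction n with
    | zero =>
      intro x hx h
      have hnot : x + Pi.single i₀ 1 ∉ box d N := fun h' => by
        have h2 := (Finset.mem_Icc.1 h').2 i₀
        simp only [Pi.add_apply, Pi.single_eq_same] at h2
        omega
      have h1 := hstep x hx
      have h2 := hout x hx hnot
      push_cast
      linarith
    | succ n ih =>
      intro x hx h
      have h1 := hstep x hx
      have hnQ : 0 ≤ (n : ℝ) * Q := by positivity
      by_cases h' : x + Pi.single i₀ 1 ∈ box d N
      · have h2 := ih _ h' (by
          simp only [Pi.add_apply, Pi.single_eq_same]
          push_cast at h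
          omega)
        push_cast
        linarith
      · have h2 := hout x hx h'
        push_cast
        linarith
  have := key (2 * N) x hx (by
    have h1 := (Finset.mem_Icc.1 hx).1 i₀
    push_cast
    simp only at h1
    omega)
  exact_mod_cast this

theorem exists_sum_sq_le_dirichlet {d : ℕ} (i₀ : Fin d) (N : ℕ) (ψ : (Fin d → ℤ) → ℝ) :
    ∃ a b : ℝ, 0 < a ∧ ∀ φ : box d N → ℝ,
      a * ∑ x, φ x ^ 2 - b ≤ dirichlet (box d N) (glue (box d N) ψ φ) := by
  set M := ∑ y ∈ boundary (box d N), |ψ y|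
  set n : ℝ := ((box d N).card : ℝ)
  have hn : 0 < n := card_box_pos d N
  set D : ℝ := n * (2 * (2 * N + 1) ^ 2)
  have hD : 0 < D := by positivity
  refine ⟨1 / D, 1 / D * (n * (2 * M ^ 2)), by positivity, fun φ => ?_⟩
  set E := dirichlet (box d N) (glue (box d N) ψ φ)
  have hE : √E ^ 2 = E := Real.sq_sqrt (dirichlet_nonneg _ _)
  have h1 : ∑ x, φ x ^ 2 ≤ n * (2 * M ^ 2 + 2 * (2 * N + 1) ^ 2 * E) := by
    have hcard : n = (Finset.univ : Finset (box d N)).card := by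
      simp [n]
    rw [hcard, ← nsmul_eq_mul]
    refine Finset.sum_le_card_nsmul _ _ _ fun x _ => ?_
    have h2 := abs_glue_box_le i₀ N ψ φ x.2
    rw [glue_coe] at h2
    have h3 : φ x ^ 2 ≤ (M + (2 * N + 1) * √E) ^ 2 := by
      rw [← sq_abs]
      exact pow_le_pow_left₀ (abs_nonneg _) h2 2
    nlinarith [sq_nonneg (M - (2 * N + 1) * √E)]
  rw [← mul_sub, one_div, inv_mul_le_iff₀ hD]
  have : D * E = n * (2 * (2 * N + 1) ^ 2 * E) := by ring
  linarith

theorem continuous_hamiltonian {d : ℕ} {V : ℝ → ℝ} (hV : Continuous V) (ξ : (Fin d → ℤ) → ℝ)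
    (Λ : Finset (Fin d → ℤ)) (ψ : (Fin d → ℤ) → ℝ) : Continuous (hamiltonian V ξ Λ ψ) := by
  unfold hamiltonian
  refine ((continuous_const.mul ?_).add ?_).add (by fun_prop)
  · refine continuous_finsetSum _ fun x _ => continuous_finsetSum _ fun y _ => ?_
    split_ifs
    · exact hV.comp (by fun_prop)
    · exact continuous_const
  · refine continuous_finsetSum _ fun x _ => continuous_finsetSum _ fun y _ => ?_
    split_ifs
    · exact hV.comp (by fun_prop)
    · exact continuous_const

theorem integrable_exp_neg_hamiltonian {d : ℕ} (i₀ : Fin d) {V : ℝ → ℝ} (hV : Continuous V)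
    {A B : ℝ} (hA : 0 < A) (hV_growth : ∀ s, A * s ^ 2 - B ≤ V s) (ξ : (Fin d → ℤ) → ℝ) (N : ℕ)
    (ψ : (Fin d → ℤ) → ℝ) :
    Integrable fun φ : box d N → ℝ => Real.exp (-hamiltonian V ξ (box d N) ψ φ) := by
  obtain ⟨a, b, ha, hab⟩ := exists_sum_sq_le_dirichlet i₀ N ψ
  set α : ℝ := A * a / 4
  have hα : 0 < α := by positivity
  set C : ℝ := A / 2 * b + (box d N).card * (3 ^ d * |B|) + ∑ x : box d N, ξ x ^ 2 / (16 * α)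
  have hint : Integrable fun φ : box d N → ℝ => Real.exp C * ∏ x, Real.exp (-α * φ x ^ 2) :=
    (Integrable.fintype_prod fun _ : box d N => integrable_exp_neg_mul_sq hα).const_mul _
  refine hint.mono' (Real.continuous_exp.comp
    (continuous_hamiltonian hV ξ _ ψ).neg).aestronglyMeasurable (ae_of_all _ fun φ => ?_)
  rw [Real.norm_eq_abs, Real.abs_exp, ← Real.exp_sum, ← Real.exp_add, Real.exp_le_exp]
  have h1 := le_hamiltonian (abs_nonneg B) hA.le
    (fun s => (sub_le_sub_left (le_abs_self B) _).trans (hV_growth s)) ξ (box d N) ψ φ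
  have h2 := mul_le_mul_of_nonneg_left (hab φ) (half_pos hA).le
  -- Young's inequality absorbs the linear term into half of the quadratic one.
  have h3 : -((1 / 2 : ℝ) * ∑ x : box d N, ξ x * φ x)
      ≤ ∑ x, α * φ x ^ 2 + ∑ x : box d N, ξ x ^ 2 / (16 * α) := by
    rw [← Finset.sum_add_distrib, Finset.mul_sum, ← Finset.sum_neg_distrib]
    refine Finset.sum_le_sum fun x _ => ?_
    have : α * φ x ^ 2 + ξ x ^ 2 / (16 * α) - -(1 / 2 * (ξ x * φ x))
        = α * (φ x + ξ x / (4 * α)) ^ 2 := by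
      field_simp
      ring
    nlinarith [mul_nonneg hα.le (sq_nonneg (φ x + ξ x / (4 * α)))]
  have h4 : A / 2 * (a * ∑ x, φ x ^ 2) = 2 * ∑ x, α * φ x ^ 2 := by
    rw [← Finset.mul_sum]
    simp only [α]
    ring
  have h5 : ∑ x, -α * φ x ^ 2 = -∑ x, α * φ x ^ 2 := by
    rw [← Finset.sum_neg_distrib]
    exact Finset.sum_congr rfl fun x _ => by ring
  rw [h5]
  simp only [C]
  linarith

/-! ### An upper bound for the surface tension -/

theorem potential_le_quadratic {V : ℝ → ℝ} (hV : ContDiff ℝ 2 V) (hV_even : ∀ s, V (-s) = V s)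
    {C₂ : ℝ} (hV_second : ∀ s, deriv (deriv V) s ≤ C₂) (s : ℝ) :
    V s ≤ V 0 + C₂ / 2 * s ^ 2 := by
  have hd : Differentiable ℝ V := hV.differentiable (by norm_num)
  have hd' : Differentiable ℝ (deriv V) := by
    have h : ContDiff ℝ (1 + 1) V := by
      rw [one_add_one_eq_two]
      exact hV
    exact ((contDiff_succ_iff_deriv.1 h).2.2).differentiable one_ne_zero
  have h0 : deriv V 0 = 0 := by
    have h := deriv_comp_neg V 0
    rw [funext hV_even, neg_zero] at h
    linarith
  have h1 : ∀ s, 0 ≤ s → deriv V s ≤ C₂ * s := fun s hs => by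
    have := image_sub_le_mul_sub_of_deriv_le hd' hV_second hs
    rwa [h0, sub_zero, sub_zero] at this
  have hder : ∀ s, HasDerivAt (fun s => V s - C₂ / 2 * s ^ 2) (deriv V s - C₂ * s) s := fun s => by
    refine ((hd s).hasDerivAt.sub ((hasDerivAt_pow 2 s).const_mul (C₂ / 2))).congr_deriv ?_
    simp
    ring
  have h2 : AntitoneOn (fun s => V s - C₂ / 2 * s ^ 2) (Set.Ici 0) := by
    refine antitoneOn_of_deriv_nonpos (convex_Ici 0)
      (fun s _ => (hder s).continuousAt.continuousWithinAt)
      (fun s _ => (hder s).differentiableAt.differentiableWithinAt) fun s hs => ?_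
    rw [interior_Ici, Set.mem_Ioi] at hs
    rw [(hder s).deriv]
    linarith [h1 s hs.le]
  have h3 : ∀ s, 0 ≤ s → V s ≤ V 0 + C₂ / 2 * s ^ 2 := fun s hs => by
    have := h2 Set.self_mem_Ici (Set.mem_Ici.2 hs) hs
    simp only at this
    linarith
  rcases le_total 0 s with hs | hs
  · exact h3 s hs
  · have := h3 (-s) (neg_nonneg.2 hs)
    rwa [hV_even, neg_sq] at this

/-- The partition function is at least the integral over the unit cube centred at any trial
configuration `c` with the right boundary values, on which the Hamiltonian exceeds its value at `c`
by at most a constant per site. -/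
theorem card_mul_surfaceTension_le {d : ℕ} (i₀ : Fin d) {V : ℝ → ℝ} (hV : ContDiff ℝ 2 V)
    (hV_even : ∀ s, V (-s) = V s) {A B C₂ : ℝ} (hA : 0 < A)
    (hV_growth : ∀ s, A * s ^ 2 - B ≤ V s) (hC₂ : 0 < C₂)
    (hV_second : ∀ s, deriv (deriv V) s ≤ C₂) (ξ : (Fin d → ℤ) → ℝ) (N : ℕ) (u : Fin d → ℝ)
    (c : (Fin d → ℤ) → ℝ) (hc : ∀ y ∉ box d N, c y = tilted u y) :
    (box d N).card * finiteVolumeSurfaceTension V ξ N u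
      ≤ (box d N).card * (3 ^ d * (|V 0| + C₂)) + C₂ * dirichlet (box d N) c
        + (1 / 2 : ℝ) * ∑ x ∈ box d N, ξ x * c x + (1 / 4 : ℝ) * ∑ x ∈ box d N, |ξ x| := by
  set Λ := box d N
  have hn : (0 : ℝ) < Λ.card := card_box_pos d N
  set b : ℝ := Λ.card * (3 ^ d * (|V 0| + C₂)) + C₂ * dirichlet Λ c
        + (1 / 2 : ℝ) * ∑ x ∈ Λ, ξ x * c x + (1 / 4 : ℝ) * ∑ x ∈ Λ, |ξ x|
  set K : Set (Λ → ℝ) := Set.Icc (fun x => c x - 1 / 2) (fun x => c x + 1 / 2)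
  have hVle : ∀ s, V s ≤ |V 0| + C₂ / 2 * s ^ 2 := fun s =>
    (potential_le_quadratic hV hV_even hV_second s).trans
      (add_le_add_left (le_abs_self _) _)
  have hH : ∀ φ ∈ K, hamiltonian V ξ Λ (tilted u) φ ≤ b := fun φ hφ => by
    have hθ : ∀ x : Λ, |φ x - c x| ≤ 1 / 2 := fun x => by
      have h1 := hφ.1 x
      have h2 := hφ.2 x
      simp only at h1 h2
      rw [abs_le]
      constructor <;> linarith
    have hg : ∀ x, |glue Λ (tilted u) φ x - c x| ≤ 1 / 2 := fun x => by
      by_cases hx : x ∈ Λ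
      · rw [show glue Λ (tilted u) φ x = φ ⟨x, hx⟩ from glue_coe Λ _ φ ⟨x, hx⟩]
        exact hθ ⟨x, hx⟩
      · rw [glue_of_notMem _ _ _ hx, hc x hx]
        norm_num
    have h1 := hamiltonian_le (abs_nonneg (V 0)) (half_pos hC₂).le hVle ξ Λ (tilted u) φ
    have h2 : dirichlet Λ (glue Λ (tilted u) φ) ≤ 2 * dirichlet Λ c + Λ.card * (3 ^ d * 2) := by
      have h3 := dirichlet_add_le Λ c (fun x => glue Λ (tilted u) φ x - c x)
      have h4 := dirichlet_le_of_lipschitz Λ (fun x => glue Λ (tilted u) φ x - c x) 1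
        fun x v _ => by
          have := abs_sub (glue Λ (tilted u) φ (x + v) - c (x + v)) (glue Λ (tilted u) φ x - c x)
          linarith [hg x, hg (x + v)]
      simp only [add_sub_cancel] at h3
      linarith
    have h3 : ∑ x : Λ, ξ x * φ x ≤ ∑ x ∈ Λ, ξ x * c x + (1 / 2 : ℝ) * ∑ x ∈ Λ, |ξ x| := by
      rw [← Finset.sum_coe_sort Λ, ← Finset.sum_coe_sort Λ, Finset.mul_sum,
        ← Finset.sum_add_distrib]
      refine Finset.sum_le_sum fun x _ => ?_
      have h4 : ξ x * (φ x - c x) ≤ |ξ x| * (1 / 2) :=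
        (le_abs_self _).trans (by
          rw [abs_mul]
          exact mul_le_mul_of_nonneg_left (hθ x) (abs_nonneg _))
      linarith
    have h4 := mul_le_mul_of_nonneg_left h2 (half_pos hC₂).le
    simp only [b]
    linarith
  have hZ : Real.exp (-b) ≤ partitionFunction V ξ Λ (tilted u) := by
    have hint := integrable_exp_neg_hamiltonian i₀ hV.continuous hA hV_growth ξ N (tilted u)
    have hvol : (volume : Measure (Λ → ℝ)).real K = 1 := by
      rw [Measure.real, Real.volume_Icc_pi_toReal]
      · refine Finset.prod_eq_one fun x _ => ?_
        ring
      · intro x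
        simp only
        linarith
    have hfin : (volume : Measure (Λ → ℝ)) K ≠ ⊤ := by
      intro h
      rw [Measure.real, h] at hvol
      simp at hvol
    have h1 := setIntegral_ge_of_const_le_real measurableSet_Icc hfin
      (fun φ hφ => Real.exp_le_exp.2 (neg_le_neg (hH φ hφ))) hint.integrableOn
    rw [hvol, mul_one] at h1
    exact h1.trans (setIntegral_le_integral hint (ae_of_all _ fun φ => (Real.exp_pos _).le))
  have hlog : -b ≤ Real.log (partitionFunction V ξ Λ (tilted u)) :=
    (Real.le_log_iff_exp_le ((Real.exp_pos _).trans_le hZ)).2 hZ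
  rw [finiteVolumeSurfaceTension]
  have : (Λ.card : ℝ) * (-(1 / (Λ.card : ℝ)) * Real.log (partitionFunction V ξ Λ (tilted u)))
      = -Real.log (partitionFunction V ξ Λ (tilted u)) := by
    field_simp
  rw [this]
  linarith

/-! ### Second moments of sums of independent centred variables -/

section Moments

variable {Ω : Type*} [MeasurableSpace Ω] {P : Measure Ω}

theorem integral_abs_le_sqrt [IsProbabilityMeasure P] {Y : Ω → ℝ} (hY : MemLp Y 2 P) :
    ∫ ω, |Y ω| ∂P ≤ √(∫ ω, Y ω ^ 2 ∂P) := by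
  have h := variance_nonneg (fun ω => |Y ω|) P
  rw [variance_eq_sub (by simpa only [Real.norm_eq_abs] using hY.norm)] at h
  refine Real.le_sqrt_of_sq_le ?_
  have h2 : P[(fun ω => |Y ω|) ^ 2] = ∫ ω, Y ω ^ 2 ∂P := by
    simp only [Pi.pow_apply, sq_abs]
  rw [h2] at h
  linarith

variable {ι : Type*} {η : ι → Ω → ℝ}

/-- A centred factor whose index occurs only once makes the fourfold moment vanish. No fourth
moments are assumed: if the remaining product is not integrable, both integrals are `0`. -/
theorem integral_mul_prod_eq_zero (hm : ∀ i, Measurable (η i)) (hi : iIndepFun η P)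
    (h0 : ∀ i, ∫ ω, η i ω ∂P = 0) {i j k l : ι} (hij : i ≠ j) (hik : i ≠ k) (hil : i ≠ l) :
    ∫ ω, η i ω * (η j ω * (η k ω * η l ω)) ∂P = 0 := by
  classical
  have hdisj : Disjoint ({i} : Finset ι) {j, k, l} := by
    simp [hij, hik, hil]
  have h := hi.indepFun_finset {i} {j, k, l} hdisj hm
  have hφ : Measurable fun z : ({i} : Finset ι) → ℝ => z ⟨i, by simp⟩ := measurable_pi_apply _
  have hψ : Measurable fun z : ({j, k, l} : Finset ι) → ℝ =>
      z ⟨j, by simp⟩ * (z ⟨k, by simp⟩ * z ⟨l, by simp⟩) := by fun_prop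
  have h2 := h.comp hφ hψ
  have h3 := h2.integral_fun_mul_eq_mul_integral
    (by exact (hm i).aestronglyMeasurable)
    (by exact ((hm j).mul ((hm k).mul (hm l))).aestronglyMeasurable)
  simp only [Function.comp_apply] at h3
  rw [h3, h0, zero_mul]

theorem memLp_mul (hi : iIndepFun η P) (hm : ∀ i, Measurable (η i)) (h2 : ∀ i, MemLp (η i) 2 P)
    {i j : ι} (hij : i ≠ j) : MemLp (fun ω => η i ω * η j ω) 2 P := by
  have hmeas : AEStronglyMeasurable (fun ω => η i ω * η j ω) P :=
    ((hm i).mul (hm j)).aestronglyMeasurable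
  rw [memLp_two_iff_integrable_sq hmeas]
  have h := ((hi.indepFun hij).comp (measurable_id.pow_const 2)
    (measurable_id.pow_const 2)).integrable_mul (h2 i).integrable_sq (h2 j).integrable_sq
  refine h.congr (ae_of_all _ fun ω => ?_)
  simp [mul_pow]

theorem integral_sq_mul_sq (hi : iIndepFun η P) (hm : ∀ i, Measurable (η i)) {v : ℝ}
    (hv : ∀ i, ∫ ω, η i ω ^ 2 ∂P = v) {i j : ι} (hij : i ≠ j) :
    ∫ ω, (η i ω * η j ω) ^ 2 ∂P = v ^ 2 := by
  have h := ((hi.indepFun hij).comp (measurable_id.pow_const 2)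
    (measurable_id.pow_const 2)).integral_fun_mul_eq_mul_integral
    (by exact ((hm i).pow_const 2).aestronglyMeasurable)
    (by exact ((hm j).pow_const 2).aestronglyMeasurable)
  simp only [Function.comp_apply, id_eq, hv] at h
  simp only [mul_pow]
  rw [h, sq]

theorem memLp_linear (h2 : ∀ i, MemLp (η i) 2 P) (s : Finset ι) (a : ι → ℝ) :
    MemLp (fun ω => ∑ i ∈ s, a i * η i ω) 2 P :=
  memLp_finsetSum _ fun i _ => (h2 i).const_mul (a i)

theorem integral_sq_linear (hi : iIndepFun η P) (hm : ∀ i, Measurable (η i))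
    (h2 : ∀ i, MemLp (η i) 2 P) (h0 : ∀ i, ∫ ω, η i ω ∂P = 0) {v : ℝ}
    (hv : ∀ i, ∫ ω, η i ω ^ 2 ∂P = v) (s : Finset ι) (a : ι → ℝ) :
    ∫ ω, (∑ i ∈ s, a i * η i ω) ^ 2 ∂P = v * ∑ i ∈ s, a i ^ 2 := by
  have hint : ∀ i j, Integrable (fun ω => a i * η i ω * (a j * η j ω)) P := fun i j =>
    ((h2 i).const_mul (a i)).integrable_mul ((h2 j).const_mul (a j))
  simp only [sq, Finset.sum_mul_sum]
  rw [integral_finsetSum _ fun i _ => integrable_finsetSum _ fun j _ => hint i j, Finset.mul_sum]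
  refine Finset.sum_congr rfl fun i his => ?_
  rw [integral_finsetSum _ fun j _ => hint i j, Finset.sum_eq_single i]
  · rw [← hv i, ← integral_mul_const]
    exact integral_congr_ae (ae_of_all _ fun ω => by ring)
  · intro j _ hji
    have h := (hi.indepFun hji.symm).integral_fun_mul_eq_mul_integral
      (hm i).aestronglyMeasurable (hm j).aestronglyMeasurable
    rw [h0, zero_mul] at h
    have h' : ∀ ω, a i * η i ω * (a j * η j ω) = a i * a j * (η i ω * η j ω) := fun ω => by ring
    simp only [h', integral_const_mul, h, mul_zero]
  · exact fun h => absurd his h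

theorem memLp_chaos [DecidableEq ι] (hi : iIndepFun η P) (hm : ∀ i, Measurable (η i))
    (h2 : ∀ i, MemLp (η i) 2 P) (s : Finset ι) (a : ι × ι → ℝ) :
    MemLp (fun ω => ∑ p ∈ s.offDiag, a p * (η p.1 ω * η p.2 ω)) 2 P :=
  memLp_finsetSum _ fun p hp => (memLp_mul hi hm h2 (Finset.mem_offDiag.1 hp).2.2).const_mul (a p)

/-- The products `η i * η j` over distinct pairs are orthogonal in `L²`, except that `(i, j)` and
`(j, i)` give the same product; hence the factor `2`. -/
theorem integral_sq_chaos_le [DecidableEq ι] (hi : iIndepFun η P) (hm : ∀ i, Measurable (η i))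
    (h2 : ∀ i, MemLp (η i) 2 P) (h0 : ∀ i, ∫ ω, η i ω ∂P = 0) {v : ℝ}
    (hv : ∀ i, ∫ ω, η i ω ^ 2 ∂P = v) (s : Finset ι) (a : ι × ι → ℝ) :
    ∫ ω, (∑ p ∈ s.offDiag, a p * (η p.1 ω * η p.2 ω)) ^ 2 ∂P
      ≤ 2 * v ^ 2 * ∑ p ∈ s.offDiag, a p ^ 2 := by
  set Z : ι × ι → Ω → ℝ := fun p ω => η p.1 ω * η p.2 ω with hZ
  have hne : ∀ p ∈ s.offDiag, p.1 ≠ p.2 := fun p hp => (Finset.mem_offDiag.1 hp).2.2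
  have hmem : ∀ p ∈ s.offDiag, MemLp (fun ω => a p * Z p ω) 2 P := fun p hp =>
    (memLp_mul hi hm h2 (hne p hp)).const_mul (a p)
  have hint : ∀ p ∈ s.offDiag, ∀ q ∈ s.offDiag,
      Integrable (fun ω => a p * Z p ω * (a q * Z q ω)) P := fun p hp q hq =>
    (hmem p hp).integrable_mul (hmem q hq)
  have hcross : ∀ p ∈ s.offDiag, ∀ q ∈ s.offDiag,
      ∫ ω, a p * Z p ω * (a q * Z q ω) ∂P
        = (if q = p then a p * a p * v ^ 2 else 0)
          + (if q = p.swap then a p * a p.swap * v ^ 2 else 0) := by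
    rintro ⟨i, j⟩ hp ⟨k, l⟩ hq
    have hij : i ≠ j := hne _ hp
    have hkl : k ≠ l := hne _ hq
    have hpull : ∀ X : Ω → ℝ, (∀ ω, Z (i, j) ω * Z (k, l) ω = X ω) →
        ∫ ω, a (i, j) * Z (i, j) ω * (a (k, l) * Z (k, l) ω) ∂P
          = a (i, j) * a (k, l) * ∫ ω, X ω ∂P := fun X hX => by
      rw [← integral_const_mul]
      exact integral_congr_ae (ae_of_all _ fun ω => by
        simp only [← hX]
        ring)
    have hsq := integral_sq_mul_sq hi hm hv hij
    by_cases h1 : i = k ∧ j = l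
    · obtain ⟨rfl, rfl⟩ := h1
      have : (i, j) ≠ (i, j).swap := fun h => hij (congrArg Prod.fst h)
      rw [if_pos rfl, if_neg this, hpull (fun ω => (η i ω * η j ω) ^ 2) fun ω => by
        simp only [hZ]
        ring, hsq]
      ring
    by_cases h2 : i = l ∧ j = k
    · obtain ⟨rfl, rfl⟩ := h2
      have : (j, i) ≠ (i, j) := fun h => hij (congrArg Prod.snd h)
      rw [if_neg this, if_pos (Prod.swap_prod_mk).symm, hpull (fun ω => (η i ω * η j ω) ^ 2) fun ω => by
        simp only [hZ]
        ring, hsq]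
      simp only [Prod.swap_prod_mk]
      ring
    have hne1 : (k, l) ≠ (i, j) := fun h =>
      h1 ⟨(congrArg Prod.fst h).symm, (congrArg Prod.snd h).symm⟩
    have hne2 : (k, l) ≠ (i, j).swap := fun h =>
      h2 ⟨(congrArg Prod.snd h).symm, (congrArg Prod.fst h).symm⟩
    rw [if_neg hne1, if_neg hne2, add_zero]
    -- One of `i`, `j` occurs only once among the four indices.
    by_cases h3 : i ≠ k ∧ i ≠ l
    · rw [hpull (fun ω => η i ω * (η j ω * (η k ω * η l ω))) fun ω => by
        simp only [hZ]
        ring, integral_mul_prod_eq_zero hm hi h0 hij h3.1 h3.2, mul_zero]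
    · have hjk : j ≠ k := by
        rintro rfl
        exact h3 ⟨hij, fun h => h2 ⟨h, rfl⟩⟩
      have hjl : j ≠ l := by
        rintro rfl
        exact h3 ⟨fun h => h1 ⟨h, rfl⟩, hij⟩
      rw [hpull (fun ω => η j ω * (η i ω * (η k ω * η l ω))) fun ω => by
        simp only [hZ]
        ring, integral_mul_prod_eq_zero hm hi h0 hij.symm hjk hjl, mul_zero]
  simp only [sq (∑ p ∈ s.offDiag, _), Finset.sum_mul_sum]
  rw [integral_finsetSum _ fun p hp => integrable_finsetSum _ fun q hq => hint p hp q hq]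
  have hrow : ∀ p ∈ s.offDiag,
      ∫ ω, ∑ q ∈ s.offDiag, a p * Z p ω * (a q * Z q ω) ∂P
        = v ^ 2 * (a p ^ 2 + a p * a p.swap) := fun p hp => by
    have hswap : p.swap ∈ s.offDiag := by
      obtain ⟨h3, h4, h5⟩ := Finset.mem_offDiag.1 hp
      exact Finset.mem_offDiag.2 ⟨h4, h3, h5.symm⟩
    rw [integral_finsetSum _ fun q hq => hint p hp q hq,
      Finset.sum_congr rfl fun q hq => hcross p hp q hq, Finset.sum_add_distrib,
      Finset.sum_ite_eq', Finset.sum_ite_eq', if_pos hp, if_pos hswap]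
    ring
  have hswapsum : ∑ p ∈ s.offDiag, a p.swap ^ 2 = ∑ p ∈ s.offDiag, a p ^ 2 :=
    Finset.sum_nbij' Prod.swap Prod.swap
      (fun p hp => by simpa [and_left_comm, eq_comm, ne_comm] using hp)
      (fun p hp => by simpa [and_left_comm, eq_comm, ne_comm] using hp)
      (fun p _ => p.swap_swap) (fun p _ => p.swap_swap) fun p _ => rfl
  rw [Finset.sum_congr rfl hrow, ← Finset.mul_sum]
  have hle : ∑ p ∈ s.offDiag, (a p ^ 2 + a p * a p.swap)
      ≤ ∑ p ∈ s.offDiag, (3 / 2 * a p ^ 2 + 1 / 2 * a p.swap ^ 2) :=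
    Finset.sum_le_sum fun p _ => by nlinarith [sq_nonneg (a p - a p.swap)]
  rw [Finset.sum_add_distrib (f := fun p => 3 / 2 * a p ^ 2), ← Finset.mul_sum,
    ← Finset.mul_sum, hswapsum] at hle
  calc _ ≤ v ^ 2 * (3 / 2 * ∑ p ∈ s.offDiag, a p ^ 2 + 1 / 2 * ∑ p ∈ s.offDiag, a p ^ 2) :=
        mul_le_mul_of_nonneg_left hle (sq_nonneg v)
    _ = _ := by ring

/-- Lower bound for sums of independent nonnegative variables: truncation at `1` makes Chebyshev's
inequality available without a fourth moment. -/
theorem measure_sum_sq_lt_le [IsProbabilityMeasure P] (hi : iIndepFun η P) (hm : ∀ i, Measurable (η i)) {μ : ℝ}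
    (hμ : ∀ i, ∫ ω, min (η i ω ^ 2) 1 ∂P = μ) (hμ0 : 0 < μ) (s : Finset ι) (hs : s.Nonempty) :
    P.real {ω | ∑ i ∈ s, η i ω ^ 2 < s.card * (μ / 2)} ≤ 4 / (s.card * μ ^ 2) := by
  set Y : ι → Ω → ℝ := fun i ω => min (η i ω ^ 2) 1
  have hYm : ∀ i, Measurable (Y i) := fun i => ((hm i).pow_const 2).min measurable_const
  have hY0 : ∀ i ω, 0 ≤ Y i ω := fun i ω => le_min (sq_nonneg _) zero_le_one
  have hY1 : ∀ i ω, Y i ω ≤ 1 := fun i ω => min_le_right _ _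
  have hYL : ∀ i, MemLp (Y i) 2 P := fun i =>
    memLp_of_bounded (a := 0) (b := 1) (ae_of_all _ fun ω => ⟨hY0 i ω, hY1 i ω⟩)
      (hYm i).aestronglyMeasurable 2
  have hn : (0 : ℝ) < s.card := by exact_mod_cast hs.card_pos
  have hvar1 : ∀ i, Var[Y i; P] ≤ 1 := fun i => by
    refine (variance_le_expectation_sq (hYm i).aestronglyMeasurable).trans ?_
    calc P[Y i ^ 2] ≤ ∫ _, (1 : ℝ) ∂P := integral_mono (f := fun ω => Y i ω ^ 2)
          (hYL i).integrable_sq (integrable_const _) fun ω => by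
            have h1 := hY0 i ω
            have h2 := hY1 i ω
            simp only
            nlinarith
      _ = 1 := by simp
  have hvar : Var[∑ i ∈ s, Y i; P] ≤ s.card := by
    rw [IndepFun.variance_sum (fun i _ => hYL i) fun i _ j _ hij =>
      (hi.indepFun hij).comp (φ := fun t : ℝ => min (t ^ 2) 1) (ψ := fun t : ℝ => min (t ^ 2) 1)
        (by fun_prop) (by fun_prop)]
    calc ∑ i ∈ s, Var[Y i; P] ≤ s.card • (1 : ℝ) :=
          Finset.sum_le_card_nsmul _ _ _ fun i _ => hvar1 i
      _ = s.card := by simp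
  have hmean : P[∑ i ∈ s, Y i] = s.card * μ := by
    simp only [Finset.sum_apply]
    rw [integral_finsetSum _ fun i _ => (hYL i).integrable one_le_two,
      Finset.sum_congr rfl fun i _ => hμ i]
    simp
  have hcheb := meas_ge_le_variance_div_sq (memLp_finsetSum' s fun i _ => hYL i)
    (c := s.card * (μ / 2)) (by positivity)
  rw [hmean] at hcheb
  have hsub : {ω | ∑ i ∈ s, η i ω ^ 2 < s.card * (μ / 2)}
      ⊆ {ω | s.card * (μ / 2) ≤ |(∑ i ∈ s, Y i) ω - s.card * μ|} := fun ω hω => by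
    simp only [Set.mem_ofPred_eq, Finset.sum_apply] at hω ⊢
    have h1 : ∑ i ∈ s, Y i ω ≤ ∑ i ∈ s, η i ω ^ 2 :=
      Finset.sum_le_sum fun i _ => min_le_left _ _
    rw [abs_sub_comm]
    refine le_trans ?_ (le_abs_self _)
    linarith
  have h1 : P.real {ω | ∑ i ∈ s, η i ω ^ 2 < s.card * (μ / 2)}
      ≤ Var[∑ i ∈ s, Y i; P] / (s.card * (μ / 2)) ^ 2 :=
    ENNReal.toReal_le_of_le_ofReal (div_nonneg (variance_nonneg _ _) (sq_nonneg _))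
      ((measure_mono hsub).trans hcheb)
  refine h1.trans ?_
  rw [div_le_div_iff₀ (by positivity) (by positivity)]
  have h2 := mul_le_mul_of_nonneg_right hvar (by positivity : 0 ≤ s.card * μ ^ 2)
  nlinarith

end Moments

/-! ### Kernels of small Dirichlet energy in dimensions one and two -/

theorem dirichlet_le_of_support {d r : ℕ} {k : (Fin d → ℤ) → ℝ} (hk : ∀ x, (r : ℝ) < ‖x‖ → k x = 0)
    (s : Finset (Fin d → ℤ)) : dirichlet s k ≤ dirichlet (box d (r + 1)) k := by
  classical
  unfold dirichlet
  rw [← Finset.sum_inter_add_sum_sdiff s (box d (r + 1)), Finset.sum_eq_zero (s := s \ _), add_zero]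
  · exact Finset.sum_le_sum_of_subset_of_nonneg Finset.inter_subset_right
      fun x _ _ => Finset.sum_nonneg fun v _ => sq_nonneg _
  · intro x hx
    refine Finset.sum_eq_zero fun v hv => ?_
    have h1 : (r : ℝ) + 1 < ‖x‖ := by
      have := (Finset.mem_sdiff.1 hx).2
      rw [mem_box, not_le] at this
      exact_mod_cast this
    have h2 := (abs_le.1 (abs_norm_add_sub_norm_le x hv)).1
    rw [hk x (by linarith), hk (x + v) (by linarith)]
    norm_num

/-- The tent function of radius `r` on `ℤ`, whose energy is of order `1 / r`. -/
theorem exists_tent (r : ℕ) (hr : 0 < r) : ∃ k : (Fin 1 → ℤ) → ℝ, k 0 = 1 ∧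
    (∀ x, (r : ℝ) < ‖x‖ → k x = 0) ∧ (∀ x, |k x| ≤ 1) ∧ ∀ s, dirichlet s k ≤ 15 / r := by
  have hr' : (1 : ℝ) ≤ r := by exact_mod_cast hr
  have hr0 : (0 : ℝ) < r := by linarith
  have hsupp : ∀ x : Fin 1 → ℤ, (r : ℝ) < ‖x‖ → max 0 (1 - ‖x‖ / r) = 0 := fun x hx => by
    refine max_eq_left ?_
    rw [sub_nonpos, one_le_div hr0]
    exact hx.le
  refine ⟨fun x => max 0 (1 - ‖x‖ / r), by simp, hsupp, fun x => ?_, fun s => ?_⟩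
  · rw [abs_of_nonneg (le_max_left _ _)]
    refine max_le zero_le_one ?_
    have : 0 ≤ ‖x‖ / r := by positivity
    linarith
  · refine (dirichlet_le_of_support hsupp s).trans ((dirichlet_le_of_lipschitz _ _ (1 / r)
      fun x v hv => ?_).trans ?_)
    · refine (abs_max_sub_max_le_max _ _ _ _).trans (max_le (by simp) ?_)
      rw [sub_sub_sub_cancel_left, ← sub_div, abs_div, abs_of_pos hr0, abs_sub_comm]
      exact div_le_div_of_nonneg_right (abs_norm_add_sub_norm_le x hv) hr0.le
    · rw [card_box]
      push_cast
      rw [le_div_iff₀ hr0]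
      have : (2 * ((r : ℝ) + 1) + 1) ^ 1 * (3 ^ 1 * (1 / r) ^ 2) * r = (6 * r + 9) / r := by
        field_simp
        ring
      rw [this, div_le_iff₀ hr0]
      linarith

theorem sum_box_two_inv_sq_le (n : ℕ) :
    ∑ x ∈ box 2 n, 1 / (1 + ‖x‖) ^ 2 ≤ 1 + 16 * Real.log (1 + n) := by
  induction n with
  | zero =>
    have : box 2 0 = {0} := by
      ext x
      rw [mem_box]
      simp
    simp [this]
  | succ n ih =>
    have hsub : box 2 n ⊆ box 2 (n + 1) := fun x hx => by
      rw [mem_box] at hx ⊢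
      push_cast
      linarith
    have hcard : ((box 2 (n + 1) \ box 2 n).card : ℝ) = 8 * (n + 1) := by
      rw [Finset.cast_card_sdiff hsub, card_box, card_box]
      push_cast
      ring
    have hshell : ∑ x ∈ box 2 (n + 1) \ box 2 n, 1 / (1 + ‖x‖) ^ 2
        ≤ (box 2 (n + 1) \ box 2 n).card • (1 / (1 + (n : ℝ)) ^ 2) := by
      refine Finset.sum_le_card_nsmul _ _ _ fun x hx => ?_
      have h := (Finset.mem_sdiff.1 hx).2
      rw [mem_box, not_le] at h
      gcongr
    have hlog : 1 / ((n : ℝ) + 2) ≤ Real.log (1 + (n + 1)) - Real.log (1 + n) := by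
      rw [← Real.log_div (by positivity) (by positivity)]
      refine le_trans ?_ (Real.one_sub_inv_le_log_of_pos (by positivity))
      apply le_of_eq
      field_simp
      ring
    have hfrac : 8 * ((n : ℝ) + 1) * (1 / (1 + (n : ℝ)) ^ 2) ≤ 16 * (1 / ((n : ℝ) + 2)) := by
      have : 8 * ((n : ℝ) + 1) * (1 / (1 + (n : ℝ)) ^ 2) = 8 / (1 + n) := by
        field_simp
        ring
      rw [this, mul_one_div, div_le_div_iff₀ (by positivity) (by positivity)]
      linarith
    rw [← Finset.sum_sdiff hsub]
    rw [nsmul_eq_mul, hcard] at hshell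
    push_cast
    linarith

/-- The logarithmic cut-off on `ℤ²`: a kernel equal to `1` at the origin, of finite support and of
arbitrarily small energy. It exists because simple random walk on `ℤ²` is recurrent. -/
theorem exists_log_cutoff {δ : ℝ} (hδ : 0 < δ) : ∃ (r : ℕ) (k : (Fin 2 → ℤ) → ℝ), k 0 = 1 ∧
    (∀ x, (r : ℝ) < ‖x‖ → k x = 0) ∧ (∀ x, |k x| ≤ 1) ∧ ∀ s, dirichlet s k ≤ δ := by
  obtain ⟨r, hr⟩ : ∃ r : ℕ, 1 + 1188 / δ ≤ Real.log (1 + r) := by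
    have h : Tendsto (fun r : ℕ => Real.log (1 + r)) atTop atTop :=
      Real.tendsto_log_atTop.comp (tendsto_atTop_add_const_left _ _ tendsto_natCast_atTop_atTop)
    exact (h.eventually_ge_atTop _).exists
  set ℓ := Real.log (1 + r)
  have hδ' : 0 < 1188 / δ := by positivity
  have hℓ1 : 1 ≤ ℓ := by linarith
  have hℓ : 0 < ℓ := by linarith
  have hsupp : ∀ x : Fin 2 → ℤ, (r : ℝ) < ‖x‖ → max 0 (1 - Real.log (1 + ‖x‖) / ℓ) = 0 :=
    fun x hx => by
      refine max_eq_left ?_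
      rw [sub_nonpos, one_le_div hℓ]
      exact Real.log_le_log (by positivity) (by linarith)
  refine ⟨r, fun x => max 0 (1 - Real.log (1 + ‖x‖) / ℓ), by simp, hsupp, fun x => ?_, fun s => ?_⟩
  · rw [abs_of_nonneg (le_max_left _ _)]
    refine max_le zero_le_one ?_
    have : 0 ≤ Real.log (1 + ‖x‖) / ℓ :=
      div_nonneg (Real.log_nonneg (by linarith [norm_nonneg x])) hℓ.le
    linarith
  refine (dirichlet_le_of_support hsupp s).trans ?_
  have hlogdiff : ∀ a b : ℝ, 0 ≤ a → 0 ≤ b → |a - b| ≤ 1 →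
      Real.log (1 + a) - Real.log (1 + b) ≤ 1 / (1 + b) := fun a b ha hb hab => by
    rw [← Real.log_div (by positivity) (by positivity)]
    refine (Real.log_le_sub_one_of_pos (by positivity)).trans ?_
    rw [div_sub_one (by positivity)]
    refine div_le_div_of_nonneg_right ?_ (by positivity)
    have := (abs_le.1 hab).2
    linarith
  have hstep : ∀ x : Fin 2 → ℤ, ∀ v ∈ unitSteps 2,
      (max 0 (1 - Real.log (1 + ‖x + v‖) / ℓ) - max 0 (1 - Real.log (1 + ‖x‖) / ℓ)) ^ 2
        ≤ 4 / ℓ ^ 2 * (1 / (1 + ‖x‖) ^ 2) := fun x v hv => by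
    have hx := norm_nonneg x
    have hxv := norm_nonneg (x + v)
    have hn := abs_norm_add_sub_norm_le x hv
    have h1 : |Real.log (1 + ‖x‖) - Real.log (1 + ‖x + v‖)| ≤ 2 / (1 + ‖x‖) := by
      have h2 := hlogdiff _ _ hxv hx hn
      have h3 := hlogdiff _ _ hx hxv (by rwa [abs_sub_comm])
      have h4 : 1 / (1 + ‖x‖) ≤ 2 / (1 + ‖x‖) := by
        gcongr
        norm_num
      have h5 : 1 / (1 + ‖x + v‖) ≤ 2 / (1 + ‖x‖) := by
        rw [div_le_div_iff₀ (by positivity) (by positivity)]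
        have := (abs_le.1 hn).1
        linarith
      rw [abs_le]
      constructor <;> linarith
    have h2 : |max 0 (1 - Real.log (1 + ‖x + v‖) / ℓ) - max 0 (1 - Real.log (1 + ‖x‖) / ℓ)|
        ≤ 2 / (1 + ‖x‖) / ℓ := by
      refine (abs_max_sub_max_le_max _ _ _ _).trans (max_le ?_ ?_)
      · rw [sub_self, abs_zero]
        positivity
      · rw [sub_sub_sub_cancel_left, ← sub_div, abs_div, abs_of_pos hℓ]
        exact div_le_div_of_nonneg_right h1 hℓ.le
    rw [← sq_abs]
    refine (pow_le_pow_left₀ (abs_nonneg _) h2 2).trans (le_of_eq ?_)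
    field_simp
    norm_num
  have hlog2 : Real.log (1 + ((r + 1 : ℕ) : ℝ)) ≤ 2 * ℓ := by
    rw [two_mul, ← Real.log_mul (by positivity) (by positivity)]
    refine Real.log_le_log (by positivity) ?_
    have h1 : 1 ≤ (r : ℝ) := by
      rcases Nat.eq_zero_or_pos r with h | h
      · simp only [ℓ, h, Nat.cast_zero, add_zero, Real.log_one] at hℓ
        exact absurd hℓ (lt_irrefl 0)
      · exact_mod_cast h
    push_cast
    nlinarith
  calc dirichlet (box 2 (r + 1)) (fun x => max 0 (1 - Real.log (1 + ‖x‖) / ℓ))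
      ≤ ∑ x ∈ box 2 (r + 1), 9 * (4 / ℓ ^ 2 * (1 / (1 + ‖x‖) ^ 2)) := by
        refine Finset.sum_le_sum fun x _ => ?_
        refine (Finset.sum_le_card_nsmul _ _ _ (hstep x)).trans ?_
        rw [nsmul_eq_mul]
        have := card_unitSteps_le 2
        refine mul_le_mul_of_nonneg_right ?_ (by positivity)
        linarith
    _ = 36 / ℓ ^ 2 * ∑ x ∈ box 2 (r + 1), 1 / (1 + ‖x‖) ^ 2 := by
        rw [Finset.mul_sum]
        exact Finset.sum_congr rfl fun x _ => by ring
    _ ≤ 36 / ℓ ^ 2 * (33 * ℓ) := by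
        refine mul_le_mul_of_nonneg_left ?_ (by positivity)
        have := sum_box_two_inv_sq_le (r + 1)
        linarith
    _ = 1188 / ℓ := by
        field_simp
        norm_num
    _ ≤ δ := by
        rw [div_le_iff₀ hℓ]
        have : 1188 / δ ≤ ℓ := by linarith
        rwa [div_le_iff₀ hδ, mul_comm] at this

/-- The amplitude `T`, box size `N`, range `r`, kernel `k` and energy `D` of the trial
configuration for centred disorder. The first bound on `ε` makes the gain `T` beat the constant
cost per site, the second the Dirichlet energy `T ^ 2 * D`, the third the fluctuations of the
disorder against the tilt, which are of order `N * √|Λ_N|` in total, and the last the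
off-diagonal part of the gain. In dimension one the third forces `T`, and hence `r`, to grow with
`N`. -/
theorem exists_kernel {d : ℕ} (hd : d = 1 ∨ d = 2) {ε : ℝ} (hε : 0 < ε) (M : ℕ) :
    ∃ (T : ℝ) (N r : ℕ) (k : (Fin d → ℤ) → ℝ) (D : ℝ), 0 < T ∧ M ≤ N ∧ 2 * r ≤ N ∧ k 0 = 1 ∧
      (∀ x, (r : ℝ) < ‖x‖ → k x = 0) ∧ (∀ x, |k x| ≤ 1) ∧ (∀ s, dirichlet s k ≤ D) ∧
      1 ≤ ε * T ∧ T * D ≤ ε ∧ (N : ℝ) ^ 2 ≤ ε ^ 2 * T ^ 2 * (box d N).card ∧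
      ((box d r).card : ℝ) ≤ ε ^ 2 * (box d N).card := by
  rcases hd with rfl | rfl
  · obtain ⟨j, hj⟩ := exists_nat_ge (2 + M + 15 / ε ^ 2 + 225 / ε ^ 4)
    have h1 : 0 ≤ 15 / ε ^ 2 := by positivity
    have h2 : 0 ≤ 225 / ε ^ 4 := by positivity
    have hM0 : (0 : ℝ) ≤ M := Nat.cast_nonneg M
    have hj2 : (2 : ℝ) ≤ j := by linarith
    have hj2' : 2 ≤ j := by exact_mod_cast hj2
    have hMj : M ≤ j := by
      have : (M : ℝ) ≤ j := by linarith
      exact_mod_cast this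
    have hj15 : 15 ≤ j * ε ^ 2 := by
      rw [← div_le_iff₀ (by positivity)]
      linarith
    have hj225 : 225 ≤ j * ε ^ 4 := by
      rw [← div_le_iff₀ (by positivity)]
      linarith
    obtain ⟨k, hk0, hks, hk1, hkD⟩ := exists_tent (j ^ 2) (by positivity)
    have hj0 : (0 : ℝ) < j := by linarith
    have hjj : (j : ℝ) ≤ j ^ 2 := by nlinarith
    refine ⟨ε * j ^ 2 / 15, j ^ 3, j ^ 2, k, 15 / (j ^ 2 : ℕ), by positivity,
      hMj.trans (Nat.le_self_pow (by norm_num) j), ?_, hk0, hks, hk1, hkD, ?_, ?_, ?_, ?_⟩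
    · rw [pow_succ' j 2]
      exact Nat.mul_le_mul_right _ hj2'
    · nlinarith [sq_nonneg ε]
    · apply le_of_eq
      push_cast
      field_simp
    · rw [card_box]
      push_cast
      have h3 : (225 : ℝ) * j ^ 6 ≤ j * ε ^ 4 * j ^ 6 :=
        mul_le_mul_of_nonneg_right hj225 (by positivity)
      have h4 : 0 ≤ ε ^ 4 * (j : ℝ) ^ 4 * (j ^ 3 + 1) := by positivity
      nlinarith
    · rw [card_box, card_box]
      push_cast
      have h3 : (15 : ℝ) * j ^ 2 ≤ j * ε ^ 2 * j ^ 2 :=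
        mul_le_mul_of_nonneg_right hj15 (by positivity)
      have h4 : 0 ≤ ε ^ 2 * ((j : ℝ) ^ 3 + 1) := by positivity
      nlinarith
  · obtain ⟨r, k, hk0, hks, hk1, hkD⟩ := exists_log_cutoff (δ := ε ^ 2) (by positivity)
    obtain ⟨N, hN⟩ := exists_nat_ge (M + 2 * r + (2 * r + 1) / ε)
    have h1 : 0 ≤ (2 * r + 1 : ℝ) / ε := by positivity
    have hM0 : (0 : ℝ) ≤ M := Nat.cast_nonneg M
    have hr0 : (0 : ℝ) ≤ r := Nat.cast_nonneg r
    have hN0 : (0 : ℝ) ≤ N := Nat.cast_nonneg N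
    refine ⟨1 / ε, N, r, k, ε ^ 2, by positivity, ?_, ?_, hk0, hks, hk1, hkD, ?_, ?_, ?_, ?_⟩
    · have : (M : ℝ) ≤ N := by linarith
      exact_mod_cast this
    · have : (2 * r : ℝ) ≤ N := by linarith
      exact_mod_cast this
    · rw [mul_one_div_cancel hε.ne']
    · apply le_of_eq
      field_simp
    · rw [card_box]
      push_cast
      have : ε ^ 2 * (1 / ε) ^ 2 = 1 := by
        field_simp
      rw [this]
      nlinarith
    · rw [card_box, card_box]
      push_cast
      rw [← mul_pow]
      refine pow_le_pow_left₀ (by positivity) ?_ 2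
      have h2 : (2 * r + 1 : ℝ) / ε ≤ N := by linarith
      rw [div_le_iff₀ hε] at h2
      nlinarith

/-! ### Trial configurations around the tilted plane -/

theorem abs_tilted_le {d : ℕ} (u : Fin d → ℝ) (x : Fin d → ℤ) :
    |tilted u x| ≤ ‖x‖ * ∑ i, |u i| := by
  unfold tilted
  rw [Finset.mul_sum]
  refine (Finset.abs_sum_le_sum_abs _ _).trans (Finset.sum_le_sum fun i _ => ?_)
  rw [abs_mul, ← Int.norm_eq_abs]
  exact mul_le_mul_of_nonneg_right (norm_le_pi_norm x i) (abs_nonneg _)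

theorem tilted_add {d : ℕ} (u : Fin d → ℝ) (x y : Fin d → ℤ) :
    tilted u (x + y) = tilted u x + tilted u y := by
  unfold tilted
  rw [← Finset.sum_add_distrib]
  exact Finset.sum_congr rfl fun i _ => by
    rw [Pi.add_apply]
    push_cast
    ring

theorem sum_box_tilted {d : ℕ} (u : Fin d → ℝ) (N : ℕ) : ∑ x ∈ box d N, tilted u x = 0 := by
  have hneg : ∑ x ∈ box d N, tilted u x = ∑ x ∈ box d N, -tilted u x := by
    refine Finset.sum_nbij' (fun x => -x) (fun x => -x) ?_ ?_ (fun x _ => neg_neg x)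
      (fun x _ => neg_neg x) fun x _ => ?_
    · intro x hx
      rwa [mem_box, norm_neg, ← mem_box]
    · intro x hx
      rwa [mem_box, norm_neg, ← mem_box]
    · simp [tilted]
  rw [Finset.sum_neg_distrib] at hneg
  linarith

theorem dirichlet_tilted_le {d : ℕ} (u : Fin d → ℝ) (Λ : Finset (Fin d → ℤ)) :
    dirichlet Λ (tilted u) ≤ Λ.card * (3 ^ d * (∑ i, |u i|) ^ 2) := by
  refine dirichlet_le_of_lipschitz _ _ _ fun x v hv => ?_
  rw [tilted_add, add_sub_cancel_left]
  refine (abs_tilted_le u v).trans ?_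
  have h : 0 ≤ ∑ i, |u i| := Finset.sum_nonneg fun i _ => abs_nonneg _
  nlinarith [norm_le_one_of_mem_unitSteps hv]

/-- The constant is the cost per site, uniform in the volume and in the disorder, of a trial
configuration `tilted u + h`. -/
theorem exists_card_mul_surfaceTension_le {d : ℕ} (i₀ : Fin d) {V : ℝ → ℝ} (hV : ContDiff ℝ 2 V)
    (hV_even : ∀ s, V (-s) = V s) {A B C₂ : ℝ} (hA : 0 < A)
    (hV_growth : ∀ s, A * s ^ 2 - B ≤ V s) (hC₂ : 0 < C₂)
    (hV_second : ∀ s, deriv (deriv V) s ≤ C₂) (u : Fin d → ℝ) :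
    ∃ κ : ℝ, 0 ≤ κ ∧ ∀ (N : ℕ) (ξ h : (Fin d → ℤ) → ℝ), (∀ y ∉ box d N, h y = 0) →
      (box d N).card * finiteVolumeSurfaceTension V ξ N u
        ≤ (box d N).card * κ + 2 * C₂ * dirichlet (box d N) h
          + (1 / 2 : ℝ) * ∑ x ∈ box d N, ξ x * (tilted u x + h x)
          + (1 / 4 : ℝ) * ∑ x ∈ box d N, |ξ x| := by
  refine ⟨3 ^ d * (|V 0| + C₂) + 2 * C₂ * (3 ^ d * (∑ i, |u i|) ^ 2), by positivity,
    fun N ξ h hh => ?_⟩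
  have h1 := card_mul_surfaceTension_le i₀ hV hV_even hA hV_growth hC₂ hV_second ξ N u
    (fun x => tilted u x + h x) fun y hy => by
      rw [hh y hy, add_zero]
  have h2 := mul_le_mul_of_nonneg_left (dirichlet_add_le (box d N) (tilted u) h) hC₂.le
  have h3 := mul_le_mul_of_nonneg_left (dirichlet_tilted_le u (box d N)) hC₂.le
  linarith

/-! ### Absence of the surface tension -/

/-- A convergent sequence is bounded below, so it suffices that for each `K` some finite-volume
surface tension lies below `-K` with probability close to one. -/
theorem ae_not_isSurfaceTension {Ω : Type*} [MeasurableSpace Ω] {P : Measure Ω}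
    [IsFiniteMeasure P] {d : ℕ} (V : ℝ → ℝ) (ξ : (Fin d → ℤ) → Ω → ℝ) (u : Fin d → ℝ)
    (h : ∀ K : ℕ, ∀ ε : ℝ, 0 < ε → ∃ N : ℕ,
      P.real {ω | -(K : ℝ) ≤ finiteVolumeSurfaceTension V (fun x => ξ x ω) N u} ≤ ε) :
    ∀ᵐ ω ∂P, ¬ ∃ σ : ℝ, IsSurfaceTension V (fun x => ξ x ω) u σ := by
  have hnull : ∀ K : ℕ, ∀ᵐ ω ∂P,
      ¬ ∀ N : ℕ, -(K : ℝ) ≤ finiteVolumeSurfaceTension V (fun x => ξ x ω) N u := fun K => by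
    rw [ae_iff]
    simp only [not_not]
    rw [← measureReal_eq_zero_iff]
    refine le_antisymm (le_of_forall_pos_le_add fun ε hε => ?_) measureReal_nonneg
    obtain ⟨N, hN⟩ := h K ε hε
    rw [zero_add]
    refine (measureReal_mono fun ω hω => ?_).trans hN
    rw [Set.mem_ofPred_eq] at hω ⊢
    exact hω N
  filter_upwards [ae_all_iff.2 hnull] with ω hω
  rintro ⟨σ, hσ⟩
  obtain ⟨b, hb⟩ := hσ.bddBelow_range
  obtain ⟨K, hK⟩ := exists_nat_ge (-b)
  exact hω K fun N => (by linarith : -(K : ℝ) ≤ b).trans (hb ⟨N, rfl⟩)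

/-! ### Disorder with nonzero mean -/

section Gain

variable {Ω : Type*} [MeasurableSpace Ω] {P : Measure Ω} [IsProbabilityMeasure P] {d : ℕ}
  {ξ : (Fin d → ℤ) → Ω → ℝ}

/-- The bump is the distance to the complement of the box in the maximum norm; it is at least `j`
on the half-size box, which holds a fraction at least `2⁻ᵈ` of the sites. -/
theorem exists_lipschitz_bump (d j : ℕ) (hj : 0 < j) : ∃ g : (Fin d → ℤ) → ℝ,
    (∀ y ∉ box d (2 * j), g y = 0) ∧ (∀ x, 0 ≤ g x ∧ g x ≤ 4 * j) ∧
      (∀ x, ∀ v ∈ unitSteps d, |g (x + v) - g x| ≤ 1) ∧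
      j * ((box d (2 * j)).card / 2 ^ d : ℝ) ≤ ∑ x ∈ box d (2 * j), g x := by
  have hj1 : (1 : ℝ) ≤ j := by exact_mod_cast hj
  have hg0 : ∀ x : Fin d → ℤ, 0 ≤ max 0 (2 * (j : ℝ) + 1 - ‖x‖) := fun x => le_max_left _ _
  refine ⟨fun x => max 0 (2 * j + 1 - ‖x‖), fun y hy => ?_, fun x => ⟨hg0 x, ?_⟩,
    fun x v hv => ?_, ?_⟩
  · -- Off the box the norm is at least `2 * j + 1`, since coordinates are integers.
    refine max_eq_left ?_
    rw [sub_nonpos]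
    by_contra hlt
    rw [not_le] at hlt
    refine hy ?_
    rw [box, Finset.mem_Icc, Pi.le_def, Pi.le_def, ← forall_and]
    intro i
    have h1 : ‖y i‖ < 2 * j + 1 := (norm_le_pi_norm y i).trans_lt hlt
    rw [Int.norm_eq_abs] at h1
    have h2 : |y i| < 2 * j + 1 := by exact_mod_cast h1
    rw [← abs_le]
    push_cast
    omega
  · refine max_le (by positivity) ?_
    linarith [norm_nonneg x]
  · refine (abs_max_sub_max_le_max _ _ _ _).trans (max_le (by simp) ?_)
    rw [sub_sub_sub_cancel_left, abs_sub_comm]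
    exact abs_norm_add_sub_norm_le x hv
  · have hsub : box d j ⊆ box d (2 * j) := fun x hx => by
      rw [mem_box] at hx ⊢
      push_cast
      linarith
    have hcard : ((box d (2 * j)).card / 2 ^ d : ℝ) ≤ (box d j).card := by
      rw [card_box, card_box, div_le_iff₀ (by positivity)]
      push_cast
      rw [← mul_pow]
      exact pow_le_pow_left₀ (by positivity) (by linarith) d
    calc j * ((box d (2 * j)).card / 2 ^ d : ℝ) ≤ (box d j).card • (j : ℝ) := by
          rw [nsmul_eq_mul, mul_comm]
          exact mul_le_mul_of_nonneg_right hcard (Nat.cast_nonneg j)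
      _ ≤ ∑ x ∈ box d j, max 0 (2 * (j : ℝ) + 1 - ‖x‖) := by
          refine Finset.card_nsmul_le_sum _ _ _ fun x hx => ?_
          rw [mem_box] at hx
          refine le_trans ?_ (le_max_right _ _)
          linarith
      _ ≤ ∑ x ∈ box d (2 * j), max 0 (2 * (j : ℝ) + 1 - ‖x‖) :=
          Finset.sum_le_sum_of_subset_of_nonneg hsub fun x _ _ => hg0 x

/-- Disorder with nonzero mean `m`: shifting the interface by `-m` times a Lipschitz bump of height
of order `N` costs a bounded energy per site and gains a multiple of `N` per site. -/
theorem measure_surfaceTension_ge_of_mean_ne_zero (hd : 0 < d) (hi : iIndepFun ξ P)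
    (hm : ∀ x, Measurable (ξ x)) (hid : ∀ x, IdentDistrib (ξ x) (ξ 0) P P)
    (h2 : MemLp (ξ 0) 2 P) (hmean : ∫ ω, ξ 0 ω ∂P ≠ 0) {V : ℝ → ℝ} {C₂ κ : ℝ} (hκ : 0 ≤ κ)
    (hC₂ : 0 < C₂) (u : Fin d → ℝ)
    (hσ : ∀ (N : ℕ) (ξ h : (Fin d → ℤ) → ℝ), (∀ y ∉ box d N, h y = 0) →
      (box d N).card * finiteVolumeSurfaceTension V ξ N u
        ≤ (box d N).card * κ + 2 * C₂ * dirichlet (box d N) h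
          + (1 / 2 : ℝ) * ∑ x ∈ box d N, ξ x * (tilted u x + h x)
          + (1 / 4 : ℝ) * ∑ x ∈ box d N, |ξ x|)
    (K : ℕ) {ε : ℝ} (hε : 0 < ε) : ∃ N : ℕ,
      P.real {ω | -(K : ℝ) ≤ finiteVolumeSurfaceTension V (fun x => ξ x ω) N u} ≤ ε := by
  set m := ∫ ω, ξ 0 ω ∂P
  have hL2 : ∀ x, MemLp (ξ x) 2 P := fun x => (hid x).memLp_iff.2 h2
  set η : (Fin d → ℤ) → Ω → ℝ := fun x ω => ξ x ω - m
  have hηi : iIndepFun η P := hi.comp (fun _ t => t - m) fun _ => measurable_id.sub_const m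
  have hηm : ∀ x, Measurable (η x) := fun x => (hm x).sub_const m
  have hη2 : ∀ x, MemLp (η x) 2 P := fun x => (hL2 x).sub (memLp_const m)
  have hη0 : ∀ x, ∫ ω, η x ω ∂P = 0 := fun x => by
    rw [integral_sub ((hL2 x).integrable one_le_two) (integrable_const m), (hid x).integral_eq]
    simp [m]
  set v := ∫ ω, η 0 ω ^ 2 ∂P
  have hηv : ∀ x, ∫ ω, η x ω ^ 2 ∂P = v := fun x =>
    ((hid x).comp ((measurable_id.sub_const m).pow_const 2)).integral_eq
  have hv0 : 0 ≤ v := integral_nonneg fun ω => sq_nonneg _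
  set a := ∫ ω, |ξ 0 ω| ∂P
  have ha : ∀ x, ∫ ω, |ξ x ω| ∂P = a := fun x => ((hid x).comp measurable_norm).integral_eq
  have ha0 : 0 ≤ a := integral_nonneg fun ω => abs_nonneg _
  set U := ∑ i, |u i|
  have hU : 0 ≤ U := Finset.sum_nonneg fun i _ => abs_nonneg _
  -- `κ'` bounds the deterministic cost per site, `G` the expected total cost.
  set κ' := K + κ + 2 * C₂ * (3 ^ d * m ^ 2)
  have hκ' : 0 ≤ κ' := by positivity
  set G := κ' + √v * (U + 2 * |m|) + a / 4
  have hG : 0 ≤ G := by positivity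
  have hm2 : 0 < m ^ 2 := by positivity
  -- Markov's inequality will bound the probability by `2 * 2 ^ d * G / (m ^ 2 * √j)`.
  obtain ⟨j, hj⟩ := exists_nat_ge (1 + (2 * 2 ^ d * G / (m ^ 2 * ε)) ^ 2)
  have hj1 : (1 : ℝ) ≤ j := by
    have := sq_nonneg (2 * 2 ^ d * G / (m ^ 2 * ε))
    linarith
  have hjpos : 0 < j := by exact_mod_cast hj1
  obtain ⟨g, hg_off, hg_bd, hg_lip, hg_sum⟩ := exists_lipschitz_bump d j hjpos
  set Λ := box d (2 * j)
  set n : ℝ := (Λ.card : ℝ)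
  have hn : 0 < n := card_box_pos d (2 * j)
  have hnj : (j : ℝ) ≤ n := by
    have h1 : (4 * j + 1 : ℝ) ≤ (4 * j + 1 : ℝ) ^ d := le_self_pow₀ (by linarith) hd.ne'
    have h3 : n = (4 * j + 1 : ℝ) ^ d := by
      simp only [n, Λ, card_box]
      push_cast
      ring
    linarith
  set c : (Fin d → ℤ) → ℝ := fun x => tilted u x + -m * g x
  have hc : ∀ x ∈ Λ, c x ^ 2 ≤ (2 * (U + 2 * |m|) * j) ^ 2 := fun x hx => by
    rw [← sq_abs]
    refine pow_le_pow_left₀ (abs_nonneg _) ?_ 2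
    have h1 : |tilted u x| ≤ 2 * j * U := by
      refine (abs_tilted_le u x).trans (mul_le_mul_of_nonneg_right ?_ hU)
      have := mem_box.1 hx
      push_cast at this
      exact this
    have h3 : |-m * g x| ≤ |m| * (4 * j) := by
      rw [abs_mul, abs_neg, abs_of_nonneg (hg_bd x).1]
      exact mul_le_mul_of_nonneg_left (hg_bd x).2 (abs_nonneg m)
    have h4 := abs_add_le (tilted u x) (-m * g x)
    simp only [c]
    linarith
  set S : Ω → ℝ := fun ω => ∑ x ∈ Λ, c x * η x ω
  have hS : MemLp S 2 P := memLp_linear hη2 Λ c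
  have hES : ∫ ω, |S ω| ∂P ≤ √v * (√n * (2 * (U + 2 * |m|) * j)) := by
    refine (integral_abs_le_sqrt hS).trans ?_
    rw [integral_sq_linear hηi hηm hη2 hη0 hηv, Real.sqrt_mul hv0]
    refine mul_le_mul_of_nonneg_left ?_ (Real.sqrt_nonneg v)
    rw [Real.sqrt_le_left (by positivity), mul_pow, Real.sq_sqrt hn.le]
    have := Finset.sum_le_card_nsmul _ _ _ hc
    rwa [nsmul_eq_mul] at this
  set Bad : Ω → ℝ := fun ω => n * κ' + (1 / 2 : ℝ) * |S ω| + (1 / 4 : ℝ) * ∑ x ∈ Λ, |ξ x ω|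
  have hSint : Integrable (fun ω => (1 / 2 : ℝ) * |S ω|) P :=
    ((hS.integrable one_le_two).abs).const_mul _
  have hξint : ∀ x ∈ Λ, Integrable (fun ω => |ξ x ω|) P := fun x _ =>
    ((hL2 x).integrable one_le_two).abs
  have hξint' : Integrable (fun ω => (1 / 4 : ℝ) * ∑ x ∈ Λ, |ξ x ω|) P :=
    (integrable_finsetSum _ hξint).const_mul _
  have hBad_int : Integrable Bad P := ((integrable_const _).add hSint).add hξint'
  have hBad0 : ∀ ω, 0 ≤ Bad ω := fun ω => by
    have : 0 ≤ ∑ x ∈ Λ, |ξ x ω| := Finset.sum_nonneg fun x _ => abs_nonneg _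
    simp only [Bad]
    positivity
  have hEBad : ∫ ω, Bad ω ∂P ≤ √n * (√n * κ' + √v * (U + 2 * |m|) * j + √n * (a / 4)) := by
    have h1 : ∫ ω, Bad ω ∂P
        = n * κ' + (1 / 2 : ℝ) * ∫ ω, |S ω| ∂P + (1 / 4 : ℝ) * (n * a) := by
      simp only [Bad]
      rw [integral_add (f := fun ω => n * κ' + (1 / 2 : ℝ) * |S ω|)
        ((integrable_const _).add hSint) hξint', integral_add (integrable_const _) hSint,
        integral_const_mul (1 / 2 : ℝ), integral_const_mul (1 / 4 : ℝ),
        integral_finsetSum _ hξint, Finset.sum_congr rfl fun x _ => ha x]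
      simp [n]
    have h3 : √n * √n = n := Real.mul_self_sqrt hn.le
    rw [h1]
    have h4 : √n * (√n * κ' + √v * (U + 2 * |m|) * j + √n * (a / 4))
        = (√n * √n) * κ' + √n * (√v * (U + 2 * |m|) * j) + (√n * √n) * (a / 4) := by ring
    rw [h4, h3]
    linarith
  have hsub : {ω | -(K : ℝ) ≤ finiteVolumeSurfaceTension V (fun x => ξ x ω) (2 * j) u}
      ⊆ {ω | m ^ 2 / 2 * (j * (n / 2 ^ d)) ≤ Bad ω} := fun ω hω => by
    rw [Set.mem_ofPred_eq] at hω ⊢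
    have h1 := hσ (2 * j) (fun x => ξ x ω) (fun x => -m * g x) fun y hy => by
      simp only [hg_off y hy, mul_zero]
    have h3 := mul_le_mul_of_nonneg_left hω hn.le
    have h4 := dirichlet_le_of_lipschitz Λ (fun x => -m * g x) |m| fun x w hw => by
      rw [← mul_sub, abs_mul, abs_neg]
      exact mul_le_of_le_one_right (abs_nonneg m) (hg_lip x w hw)
    rw [sq_abs] at h4
    have h5 : ∑ x ∈ Λ, ξ x ω * (tilted u x + -m * g x) = S ω - m ^ 2 * ∑ x ∈ Λ, g x := by
      have h6 : ∀ x, ξ x ω * (tilted u x + -m * g x)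
          = c x * η x ω + (m * tilted u x - m ^ 2 * g x) := fun x => by
        simp only [c, η]
        ring
      rw [Finset.sum_congr rfl fun x _ => h6 x, Finset.sum_add_distrib, Finset.sum_sub_distrib,
        ← Finset.mul_sum, ← Finset.mul_sum, sum_box_tilted]
      ring
    have h7 := mul_le_mul_of_nonneg_left h4 hC₂.le
    have h8 := mul_le_mul_of_nonneg_left hg_sum hm2.le
    have h9 := le_abs_self (S ω)
    simp only [Bad, κ']
    rw [h5] at h1
    linarith
  refine ⟨2 * j, (measureReal_mono hsub).trans ?_⟩
  have hmarkov := mul_meas_ge_le_integral_of_nonneg (ae_of_all P hBad0) hBad_int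
    (m ^ 2 / 2 * (j * (n / 2 ^ d)))
  set p := P.real {ω | m ^ 2 / 2 * (j * (n / 2 ^ d)) ≤ Bad ω}
  have hsn : 0 < √n := Real.sqrt_pos.2 hn
  have hsj : 0 < √(j : ℝ) := Real.sqrt_pos.2 (by linarith)
  have hsjn : √(j : ℝ) ≤ √n := Real.sqrt_le_sqrt hnj
  have hsj1 : 1 ≤ √(j : ℝ) := Real.one_le_sqrt.2 hj1
  have hsjj : √(j : ℝ) * √(j : ℝ) = j := Real.mul_self_sqrt (by linarith)
  have hsnn : √n * √n = n := Real.mul_self_sqrt hn.le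
  have hfinal : m ^ 2 / 2 * j / 2 ^ d * n * p ≤ n * (√(j : ℝ) * G) := by
    have h1 : m ^ 2 / 2 * j / 2 ^ d * n * p = m ^ 2 / 2 * (j * (n / 2 ^ d)) * p := by ring
    rw [h1]
    refine (hmarkov.trans hEBad).trans ?_
    have h3 : (j : ℝ) ≤ √n * √(j : ℝ) := by
      nlinarith
    have h4 : √n ≤ √n * √(j : ℝ) := le_mul_of_one_le_right hsn.le hsj1
    have h5 : √n * κ' + √v * (U + 2 * |m|) * j + √n * (a / 4) ≤ √n * √(j : ℝ) * G := by
      have h6 := mul_le_mul_of_nonneg_right h4 hκ'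
      have h7 := mul_le_mul_of_nonneg_left h3 (by positivity : 0 ≤ √v * (U + 2 * |m|))
      have h8 := mul_le_mul_of_nonneg_right h4 (by positivity : 0 ≤ a / 4)
      simp only [G]
      linarith
    calc √n * (√n * κ' + √v * (U + 2 * |m|) * j + √n * (a / 4))
        ≤ √n * (√n * √(j : ℝ) * G) := mul_le_mul_of_nonneg_left h5 hsn.le
      _ = n * (√(j : ℝ) * G) := by
          rw [← mul_assoc, ← mul_assoc, hsnn, mul_assoc]
  have hcancel : √(j : ℝ) * p ≤ 2 * 2 ^ d * G / m ^ 2 := by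
    rw [le_div_iff₀ hm2]
    have h1 : 0 < n * √(j : ℝ) / (2 * 2 ^ d) := by positivity
    refine le_of_mul_le_mul_left ?_ h1
    calc n * √(j : ℝ) / (2 * 2 ^ d) * (√(j : ℝ) * p * m ^ 2)
        = m ^ 2 / 2 * (√(j : ℝ) * √(j : ℝ)) / 2 ^ d * n * p := by ring
      _ ≤ n * (√(j : ℝ) * G) := by rwa [hsjj]
      _ = n * √(j : ℝ) / (2 * 2 ^ d) * (2 * 2 ^ d * G) := by
          field_simp
  have hlarge : 2 * 2 ^ d * G / (m ^ 2 * ε) ≤ √(j : ℝ) :=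
    Real.le_sqrt_of_sq_le (by linarith)
  rw [← div_div, div_le_iff₀ hε] at hlarge
  exact le_of_mul_le_mul_left (hcancel.trans hlarge) hsj

end Gain

/-! ### Centred disorder -/

section CentredGain

variable {Ω : Type*} [MeasurableSpace Ω] {P : Measure Ω} {d : ℕ} {ξ : (Fin d → ℤ) → Ω → ℝ}

/-- The response `-T (k * ξ)` of the interface to the disorder, where only the disorder in `Λ` is
used. -/
def response (T : ℝ) (k : (Fin d → ℤ) → ℝ) (Λ : Finset (Fin d → ℤ)) (ξ : (Fin d → ℤ) → ℝ)
    (x : Fin d → ℤ) : ℝ :=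
  ∑ y ∈ Λ, -T * k (x - y) * ξ y

theorem response_eq_zero {N r : ℕ} (hr : r ≤ N) (T : ℝ) {k : (Fin d → ℤ) → ℝ}
    (hk : ∀ x, (r : ℝ) < ‖x‖ → k x = 0) (ξ : (Fin d → ℤ) → ℝ) {x : Fin d → ℤ}
    (hx : x ∉ box d N) : response T k (box d (N - r)) ξ x = 0 := by
  refine Finset.sum_eq_zero fun y hy => ?_
  rw [mem_box, not_le] at hx
  rw [mem_box, Nat.cast_sub hr] at hy
  have h := norm_sub_norm_le x y
  rw [hk (x - y) (by linarith), mul_zero, zero_mul]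

/-- The gain splits into a diagonal part with a sign and an off-diagonal part that only
fluctuates. -/
theorem sum_mul_response (T : ℝ) {k : (Fin d → ℤ) → ℝ} (hk0 : k 0 = 1)
    {Λ Λ' : Finset (Fin d → ℤ)} (hΛ : Λ' ⊆ Λ) (ξ : (Fin d → ℤ) → ℝ) :
    ∑ x ∈ Λ, ξ x * response T k Λ' ξ x = -T * (∑ y ∈ Λ', ξ y ^ 2
      + ∑ p ∈ Λ.offDiag, (if p.2 ∈ Λ' then k (p.1 - p.2) else 0) * (ξ p.1 * ξ p.2)) := by
  set f : (Fin d → ℤ) × (Fin d → ℤ) → ℝ :=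
    fun p => (if p.2 ∈ Λ' then k (p.1 - p.2) else 0) * (ξ p.1 * ξ p.2)
  have h1 : ∀ x, ξ x * response T k Λ' ξ x = -T * ∑ y ∈ Λ, f (x, y) := fun x => by
    rw [response, ← Finset.sum_subset hΛ (f := fun y => f (x, y)) fun y _ hy => by simp [f, hy],
      Finset.mul_sum, Finset.mul_sum]
    refine Finset.sum_congr rfl fun y hy => ?_
    simp only [f, if_pos hy]
    ring
  have h2 : ∑ p ∈ Λ.diag, f p = ∑ y ∈ Λ', ξ y ^ 2 := by
    rw [Finset.sum_diag, ← Finset.sum_subset hΛ (f := fun y => f (y, y)) fun y _ hy => by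
      simp [f, hy]]
    refine Finset.sum_congr rfl fun y hy => ?_
    simp only [f, if_pos hy, sub_self, hk0]
    ring
  rw [Finset.sum_congr rfl fun x _ => h1 x, ← Finset.mul_sum, ← Finset.sum_product',
    ← Finset.diag_union_offDiag, Finset.sum_union (Finset.disjoint_diag_offDiag Λ), h2]

theorem integrable_dirichlet_response (h2 : ∀ x, MemLp (ξ x) 2 P) (T : ℝ) (k : (Fin d → ℤ) → ℝ)
    (Λ Λ' : Finset (Fin d → ℤ)) :
    Integrable (fun ω => dirichlet Λ (response T k Λ' fun x => ξ x ω)) P := by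
  unfold dirichlet
  refine integrable_finsetSum _ fun x _ => integrable_finsetSum _ fun v _ => ?_
  exact MemLp.integrable_sq ((memLp_linear h2 Λ' _).sub (memLp_linear h2 Λ' _))

theorem integral_dirichlet_response_le (hi : iIndepFun ξ P) (hm : ∀ x, Measurable (ξ x))
    (h2 : ∀ x, MemLp (ξ x) 2 P) (h0 : ∀ x, ∫ ω, ξ x ω ∂P = 0) {v : ℝ} (hv0 : 0 ≤ v)
    (hv : ∀ x, ∫ ω, ξ x ω ^ 2 ∂P = v) (T : ℝ) {k : (Fin d → ℤ) → ℝ} {D : ℝ}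
    (hD : ∀ s, dirichlet s k ≤ D) (Λ Λ' : Finset (Fin d → ℤ)) :
    ∫ ω, dirichlet Λ (response T k Λ' fun x => ξ x ω) ∂P ≤ v * T ^ 2 * (Λ'.card * D) := by
  have hlin : ∀ x w ω, response T k Λ' (fun x => ξ x ω) (x + w)
      - response T k Λ' (fun x => ξ x ω) x
        = ∑ y ∈ Λ', -T * (k (x + w - y) - k (x - y)) * ξ y ω := fun x w ω => by
    unfold response
    rw [← Finset.sum_sub_distrib]
    exact Finset.sum_congr rfl fun y _ => by ring
  have hint : ∀ x w, Integrable (fun ω => (response T k Λ' (fun x => ξ x ω) (x + w)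
      - response T k Λ' (fun x => ξ x ω) x) ^ 2) P := fun x w => by
    simp only [hlin]
    exact (memLp_linear h2 Λ' _).integrable_sq
  have heq : ∫ ω, dirichlet Λ (response T k Λ' fun x => ξ x ω) ∂P
      = v * T ^ 2 * ∑ y ∈ Λ', dirichlet Λ fun x => k (x - y) := by
    unfold dirichlet
    rw [integral_finsetSum _ fun x _ => integrable_finsetSum _ fun w _ => hint x w,
      Finset.sum_comm, Finset.mul_sum]
    refine Finset.sum_congr rfl fun x _ => ?_
    rw [integral_finsetSum _ fun w _ => hint x w, Finset.sum_comm, Finset.mul_sum]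
    refine Finset.sum_congr rfl fun w _ => ?_
    simp only [hlin]
    rw [integral_sq_linear hi hm h2 h0 hv, Finset.mul_sum, Finset.mul_sum]
    exact Finset.sum_congr rfl fun y _ => by ring
  rw [heq, ← nsmul_eq_mul]
  refine mul_le_mul_of_nonneg_left (Finset.sum_le_card_nsmul _ _ _ fun y _ => ?_) (by positivity)
  rw [dirichlet_comp_sub]
  exact hD _

theorem sum_offDiag_kernel_sq_le {r : ℕ} {k : (Fin d → ℤ) → ℝ}
    (hk : ∀ x, (r : ℝ) < ‖x‖ → k x = 0) (hk1 : ∀ x, |k x| ≤ 1) (Λ Λ' : Finset (Fin d → ℤ)) :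
    ∑ p ∈ Λ.offDiag, (if p.2 ∈ Λ' then k (p.1 - p.2) else 0) ^ 2
      ≤ Λ.card * ((box d r).card : ℝ) := by
  calc ∑ p ∈ Λ.offDiag, (if p.2 ∈ Λ' then k (p.1 - p.2) else 0) ^ 2
      ≤ ∑ p ∈ Λ.offDiag, k (p.1 - p.2) ^ 2 := Finset.sum_le_sum fun p _ => by
        split_ifs
        · exact le_rfl
        · rw [zero_pow two_ne_zero]
          exact sq_nonneg _
    _ ≤ ∑ p ∈ Λ ×ˢ Λ, k (p.1 - p.2) ^ 2 :=
        Finset.sum_le_sum_of_subset_of_nonneg (fun p hp =>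
          Finset.mem_product.2 ⟨(Finset.mem_offDiag.1 hp).1, (Finset.mem_offDiag.1 hp).2.1⟩)
          fun p _ _ => sq_nonneg _
    _ = ∑ y ∈ Λ, ∑ x ∈ Λ, k (x - y) ^ 2 := Finset.sum_product_right _ _ _
    _ ≤ Λ.card • ((box d r).card : ℝ) := by
        refine Finset.sum_le_card_nsmul _ _ _ fun y _ => ?_
        rw [← Finset.sum_image (g := fun x => x - y) (f := fun x => k x ^ 2)
          (fun a _ b _ h => sub_left_injective h)]
        calc ∑ x ∈ Λ.image (fun x => x - y), k x ^ 2
            ≤ ∑ x ∈ Λ.image (fun x => x - y), if x ∈ box d r then (1 : ℝ) else 0 :=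
              Finset.sum_le_sum fun x _ => by
                split_ifs with hx
                · rw [sq_le_one_iff_abs_le_one]
                  exact hk1 x
                · rw [mem_box, not_le] at hx
                  rw [hk x hx, zero_pow two_ne_zero]
          _ ≤ (box d r).card := by
              rw [← Finset.sum_filter, Finset.sum_const, nsmul_eq_mul, mul_one]
              exact_mod_cast Finset.card_le_card fun x hx => (Finset.mem_filter.1 hx).2
    _ = Λ.card * ((box d r).card : ℝ) := nsmul_eq_mul _ _

theorem integral_abs_chaos_kernel_le [IsProbabilityMeasure P] (hi : iIndepFun ξ P)
    (hm : ∀ x, Measurable (ξ x)) (h2 : ∀ x, MemLp (ξ x) 2 P) (h0 : ∀ x, ∫ ω, ξ x ω ∂P = 0) {v : ℝ}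
    (hv0 : 0 ≤ v) (hv : ∀ x, ∫ ω, ξ x ω ^ 2 ∂P = v) {r : ℕ} {k : (Fin d → ℤ) → ℝ}
    (hk : ∀ x, (r : ℝ) < ‖x‖ → k x = 0) (hk1 : ∀ x, |k x| ≤ 1) (Λ Λ' : Finset (Fin d → ℤ))
    {δ : ℝ} (hδ : 0 ≤ δ) (hr : ((box d r).card : ℝ) ≤ δ ^ 2 * Λ.card) :
    ∫ ω, |∑ p ∈ Λ.offDiag, (if p.2 ∈ Λ' then k (p.1 - p.2) else 0) * (ξ p.1 ω * ξ p.2 ω)| ∂P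
      ≤ 2 * v * δ * Λ.card := by
  refine (integral_abs_le_sqrt (memLp_chaos hi hm h2 Λ _)).trans ?_
  rw [Real.sqrt_le_left (by positivity)]
  refine (integral_sq_chaos_le hi hm h2 h0 hv Λ _).trans ?_
  have h3 := (sum_offDiag_kernel_sq_le hk hk1 Λ Λ').trans
    (mul_le_mul_of_nonneg_left hr (Nat.cast_nonneg _))
  have h4 := mul_le_mul_of_nonneg_left h3 (by positivity : 0 ≤ 2 * v ^ 2)
  have h5 : 0 ≤ v ^ 2 * δ ^ 2 * (Λ.card : ℝ) ^ 2 := by positivity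
  linarith

theorem integral_abs_sum_tilted_le [IsProbabilityMeasure P] (hi : iIndepFun ξ P)
    (hm : ∀ x, Measurable (ξ x)) (h2 : ∀ x, MemLp (ξ x) 2 P) (h0 : ∀ x, ∫ ω, ξ x ω ∂P = 0) {v : ℝ}
    (hv0 : 0 ≤ v) (hv : ∀ x, ∫ ω, ξ x ω ^ 2 ∂P = v) (u : Fin d → ℝ) {N : ℕ} {b : ℝ} (hb : 0 ≤ b)
    (hN : (box d N).card * (N : ℝ) ^ 2 ≤ b ^ 2) :
    ∫ ω, |∑ x ∈ box d N, tilted u x * ξ x ω| ∂P ≤ √v * ((∑ i, |u i|) * b) := by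
  have hU : 0 ≤ ∑ i, |u i| := Finset.sum_nonneg fun i _ => abs_nonneg _
  refine (integral_abs_le_sqrt (memLp_linear h2 _ _)).trans ?_
  rw [integral_sq_linear hi hm h2 h0 hv, Real.sqrt_mul hv0]
  refine mul_le_mul_of_nonneg_left ?_ (Real.sqrt_nonneg v)
  rw [Real.sqrt_le_left (by positivity)]
  have h3 : ∑ x ∈ box d N, tilted u x ^ 2 ≤ (box d N).card • ((N : ℝ) * ∑ i, |u i|) ^ 2 :=
    Finset.sum_le_card_nsmul _ _ _ fun x hx => by
      rw [← sq_abs]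
      refine pow_le_pow_left₀ (abs_nonneg _) ((abs_tilted_le u x).trans ?_) 2
      exact mul_le_mul_of_nonneg_right (mem_box.1 hx) hU
  rw [nsmul_eq_mul] at h3
  refine h3.trans ?_
  rw [mul_pow, mul_pow, ← mul_assoc, mul_comm (_ ^ 2) (b ^ 2)]
  exact mul_le_mul_of_nonneg_right hN (sq_nonneg _)

theorem integral_min_sq_one_pos [IsFiniteMeasure P] {Y : Ω → ℝ} (hY : MemLp Y 2 P)
    (hne : ∫ ω, Y ω ^ 2 ∂P ≠ 0) : 0 < ∫ ω, min (Y ω ^ 2) 1 ∂P := by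
  have hnn : ∀ ω, 0 ≤ min (Y ω ^ 2) 1 := fun ω => le_min (sq_nonneg _) zero_le_one
  have hint : Integrable (fun ω => min (Y ω ^ 2) 1) P :=
    hY.integrable_sq.inf (integrable_const 1)
  refine lt_of_le_of_ne (integral_nonneg hnn) fun h => hne ?_
  have h3 := (integral_eq_zero_iff_of_nonneg hnn hint).1 h.symm
  refine integral_eq_zero_of_ae (h3.mono fun ω hω => ?_)
  simp only [Pi.zero_apply] at hω ⊢
  rcases min_choice (Y ω ^ 2) 1 with h4 | h4
  · rwa [h4] at hω
  · rw [h4] at hω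
    exact absurd hω one_ne_zero

set_option maxHeartbeats 600000 in
/-- Centred disorder in dimension at most two: letting the interface follow `-T (k * ξ)` gains
`T * ∑ ξ ^ 2`, which beats the Dirichlet energy because `k` has small energy. -/
theorem measure_surfaceTension_ge_of_mean_eq_zero [IsProbabilityMeasure P] (hd : d = 1 ∨ d = 2)
    (hi : iIndepFun ξ P)
    (hm : ∀ x, Measurable (ξ x)) (hid : ∀ x, IdentDistrib (ξ x) (ξ 0) P P)
    (h2 : MemLp (ξ 0) 2 P) (hmean : ∫ ω, ξ 0 ω ∂P = 0) (hne : ∫ ω, ξ 0 ω ^ 2 ∂P ≠ 0)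
    {V : ℝ → ℝ} {C₂ κ : ℝ} (hκ : 0 ≤ κ) (hC₂ : 0 < C₂) (u : Fin d → ℝ)
    (hσ : ∀ (N : ℕ) (ξ h : (Fin d → ℤ) → ℝ), (∀ y ∉ box d N, h y = 0) →
      (box d N).card * finiteVolumeSurfaceTension V ξ N u
        ≤ (box d N).card * κ + 2 * C₂ * dirichlet (box d N) h
          + (1 / 2 : ℝ) * ∑ x ∈ box d N, ξ x * (tilted u x + h x)
          + (1 / 4 : ℝ) * ∑ x ∈ box d N, |ξ x|)
    (K : ℕ) {ε : ℝ} (hε : 0 < ε) : ∃ N : ℕ,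
      P.real {ω | -(K : ℝ) ≤ finiteVolumeSurfaceTension V (fun x => ξ x ω) N u} ≤ ε := by
  have hL2 : ∀ x, MemLp (ξ x) 2 P := fun x => (hid x).memLp_iff.2 h2
  have h0 : ∀ x, ∫ ω, ξ x ω ∂P = 0 := fun x => (hid x).integral_eq.trans hmean
  set v := ∫ ω, ξ 0 ω ^ 2 ∂P
  have hv : ∀ x, ∫ ω, ξ x ω ^ 2 ∂P = v := fun x =>
    ((hid x).comp (measurable_id.pow_const 2)).integral_eq
  have hv0 : 0 ≤ v := integral_nonneg fun ω => sq_nonneg _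
  set a := ∫ ω, |ξ 0 ω| ∂P
  have ha : ∀ x, ∫ ω, |ξ x ω| ∂P = a := fun x => ((hid x).comp measurable_norm).integral_eq
  have ha0 : 0 ≤ a := integral_nonneg fun ω => abs_nonneg _
  set μ := ∫ ω, min (ξ 0 ω ^ 2) 1 ∂P
  have hμ : ∀ x, ∫ ω, min (ξ x ω ^ 2) 1 ∂P = μ := fun x =>
    ((hid x).comp ((measurable_id.pow_const 2).min measurable_const)).integral_eq
  have hμ0 : 0 < μ := integral_min_sq_one_pos h2 hne
  set U := ∑ i, |u i|
  have hU : 0 ≤ U := Finset.sum_nonneg fun i _ => abs_nonneg _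
  clear_value v a μ
  have hKκ : 0 ≤ (K : ℝ) + κ := by positivity
  set G := (K : ℝ) + κ + 2 * C₂ * v + √v * U + v + a
  have hG : 0 ≤ G := by positivity
  -- `δ` is chosen so that the Markov bound below is at most `ε / 2`.
  set δ := ε * μ / (8 * 2 ^ d * (G + 1))
  have hδ : 0 < δ := by positivity
  obtain ⟨M, hM⟩ := exists_nat_ge (8 / (ε * μ ^ 2))
  obtain ⟨T, N, r, k, D, hT, hMN, hrN, hk0, hks, hk1, hkD, hδT, hTD, hNT, hrn⟩ :=
    exists_kernel hd hδ (2 * M)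
  have hrN' : r ≤ N := by omega
  have hd0 : d ≠ 0 := by omega
  set Λ := box d N
  set Λ' := box d (N - r)
  set n : ℝ := (Λ.card : ℝ)
  set n' : ℝ := (Λ'.card : ℝ)
  have hn : 0 < n := card_box_pos d N
  have hn' : 0 < n' := card_box_pos d (N - r)
  have hsub : Λ' ⊆ Λ := fun x hx => by
    rw [mem_box] at hx ⊢
    refine hx.trans ?_
    exact_mod_cast Nat.sub_le N r
  have hn'n : n' ≤ n := by
    simp only [n, n']
    exact_mod_cast Finset.card_le_card hsub
  have hnn' : n ≤ 2 ^ d * n' := by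
    simp only [n, n', Λ, Λ', card_box]
    push_cast [Nat.cast_sub hrN']
    rw [← mul_pow]
    have h3 : (2 * r : ℝ) ≤ N := by exact_mod_cast hrN
    exact pow_le_pow_left₀ (by positivity) (by linarith) d
  have hMn' : (M : ℝ) ≤ n' := by
    have h3 : M ≤ (2 * (N - r) + 1) ^ d :=
      (by omega : M ≤ 2 * (N - r) + 1).trans (Nat.le_self_pow hd0 _)
    simp only [n', Λ', card_box]
    exact_mod_cast h3
  set E : Ω → ℝ := fun ω => dirichlet Λ (response T k Λ' fun x => ξ x ω)
  set L : Ω → ℝ := fun ω => ∑ x ∈ Λ, tilted u x * ξ x ω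
  set X : Ω → ℝ := fun ω =>
    ∑ p ∈ Λ.offDiag, (if p.2 ∈ Λ' then k (p.1 - p.2) else 0) * (ξ p.1 ω * ξ p.2 ω)
  have hE0 : ∀ ω, 0 ≤ E ω := fun ω => dirichlet_nonneg _ _
  have hEint : Integrable E P := integrable_dirichlet_response hL2 T k Λ Λ'
  have hEE : ∫ ω, E ω ∂P ≤ v * T * δ * n := by
    refine (integral_dirichlet_response_le hi hm hL2 h0 hv0 hv T hkD Λ Λ').trans ?_
    calc v * T ^ 2 * (n' * D) = v * T * n' * (T * D) := by ring
      _ ≤ v * T * n' * δ := mul_le_mul_of_nonneg_left hTD (by positivity)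
      _ ≤ v * T * n * δ := by gcongr
      _ = v * T * δ * n := by ring
  have hL : MemLp L 2 P := memLp_linear hL2 Λ _
  have hEL : ∫ ω, |L ω| ∂P ≤ √v * (U * (δ * T * n)) := by
    refine integral_abs_sum_tilted_le hi hm hL2 h0 hv0 hv u (by positivity) ?_
    calc n * (N : ℝ) ^ 2 ≤ n * (δ ^ 2 * T ^ 2 * n) := mul_le_mul_of_nonneg_left hNT hn.le
      _ = (δ * T * n) ^ 2 := by ring
  have hX : MemLp X 2 P := memLp_chaos hi hm hL2 Λ _
  have hEX : ∫ ω, |X ω| ∂P ≤ 2 * v * δ * n :=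
    integral_abs_chaos_kernel_le hi hm hL2 h0 hv0 hv hks hk1 Λ Λ' hδ.le hrn
  set Bad : Ω → ℝ := fun ω => n * (K + κ) + 2 * C₂ * E ω + (1 / 2 : ℝ) * |L ω|
    + T / 2 * |X ω| + (1 / 4 : ℝ) * ∑ x ∈ Λ, |ξ x ω|
  have hi1 : Integrable (fun _ : Ω => n * (K + κ)) P := integrable_const _
  have hi2 : Integrable (fun ω => 2 * C₂ * E ω) P := hEint.const_mul _
  have hi3 : Integrable (fun ω => (1 / 2 : ℝ) * |L ω|) P :=
    ((hL.integrable one_le_two).abs).const_mul _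
  have hi4 : Integrable (fun ω => T / 2 * |X ω|) P :=
    ((hX.integrable one_le_two).abs).const_mul _
  have hξint : ∀ x ∈ Λ, Integrable (fun ω => |ξ x ω|) P := fun x _ =>
    ((hL2 x).integrable one_le_two).abs
  have hi5 : Integrable (fun ω => (1 / 4 : ℝ) * ∑ x ∈ Λ, |ξ x ω|) P :=
    (integrable_finsetSum _ hξint).const_mul _
  have hi12 : Integrable (fun ω => n * (K + κ) + 2 * C₂ * E ω) P := hi1.add hi2
  have hi123 : Integrable (fun ω => n * (K + κ) + 2 * C₂ * E ω + (1 / 2 : ℝ) * |L ω|) P :=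
    hi12.add hi3
  have hi1234 : Integrable (fun ω => n * (K + κ) + 2 * C₂ * E ω + (1 / 2 : ℝ) * |L ω|
      + T / 2 * |X ω|) P := hi123.add hi4
  have hBad_int : Integrable Bad P := hi1234.add hi5
  have hBad0 : ∀ ω, 0 ≤ Bad ω := fun ω => by
    have h3 : 0 ≤ ∑ x ∈ Λ, |ξ x ω| := Finset.sum_nonneg fun x _ => abs_nonneg _
    have h4 := hE0 ω
    simp only [Bad]
    positivity
  have hEBad : ∫ ω, Bad ω ∂P ≤ δ * T * n * G := by
    have h3 : ∫ ω, Bad ω ∂P = n * (K + κ) + 2 * C₂ * ∫ ω, E ω ∂P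
        + (1 / 2 : ℝ) * ∫ ω, |L ω| ∂P + T / 2 * ∫ ω, |X ω| ∂P + (1 / 4 : ℝ) * (n * a) := by
      rw [← integral_const_mul, ← integral_const_mul, ← integral_const_mul]
      have h4 : (1 / 4 : ℝ) * (n * a) = ∫ ω, (1 / 4 : ℝ) * ∑ x ∈ Λ, |ξ x ω| ∂P := by
        rw [integral_const_mul (1 / 4 : ℝ), integral_finsetSum _ hξint,
          Finset.sum_congr rfl fun x _ => ha x]
        simp [n]
      have h5 : n * (K + κ) = ∫ _, n * (K + κ) ∂P := by simp
      rw [h4, h5, ← integral_add hi1 hi2, ← integral_add hi12 hi3, ← integral_add hi123 hi4,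
        ← integral_add hi1234 hi5]
    rw [h3]
    have h4 := mul_le_mul_of_nonneg_left hδT (by positivity : 0 ≤ n * (K + κ))
    have h5 := mul_le_mul_of_nonneg_left hEE (by positivity : 0 ≤ 2 * C₂)
    have h6 := mul_le_mul_of_nonneg_left hEX (half_pos hT).le
    have h7 := mul_le_mul_of_nonneg_left hδT (by positivity : 0 ≤ n * a)
    have h8 : 0 ≤ √v * (U * (δ * T * n)) := by positivity
    have h9 : 0 ≤ n * a := by positivity
    simp only [G]
    linarith
  -- Either the diagonal gain is atypically small or the nonnegative cost `Bad` exceeds it.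
  have hcover : {ω | -(K : ℝ) ≤ finiteVolumeSurfaceTension V (fun x => ξ x ω) N u}
      ⊆ {ω | ∑ x ∈ Λ', ξ x ω ^ 2 < n' * (μ / 2)} ∪ {ω | T / 2 * (n' * (μ / 2)) ≤ Bad ω} := by
    intro ω hω
    rw [Set.mem_ofPred_eq] at hω
    rw [Set.mem_union, Set.mem_ofPred_eq, Set.mem_ofPred_eq]
    refine (lt_or_ge _ _).imp_right fun hW => ?_
    have h3 := hσ N (fun x => ξ x ω) (response T k Λ' fun x => ξ x ω)
      fun y hy => response_eq_zero hrN' T hks _ hy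
    have h4 := mul_le_mul_of_nonneg_left hω hn.le
    have h5 : ∑ x ∈ Λ, ξ x ω * (tilted u x + response T k Λ' (fun x => ξ x ω) x)
        = L ω + -T * (∑ y ∈ Λ', ξ y ω ^ 2 + X ω) := by
      rw [← sum_mul_response T hk0 hsub fun x => ξ x ω, ← Finset.sum_add_distrib]
      exact Finset.sum_congr rfl fun x _ => by ring
    rw [h5] at h3
    have h6 := le_abs_self (L ω)
    have h7 := mul_le_mul_of_nonneg_left (neg_abs_le (X ω)) hT.le
    have h8 := mul_le_mul_of_nonneg_left hW (half_pos hT).le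
    simp only [Bad, E]
    linarith
  refine ⟨N, (measureReal_mono hcover).trans ((measureReal_union_le _ _).trans ?_)⟩
  have hfirst : P.real {ω | ∑ x ∈ Λ', ξ x ω ^ 2 < n' * (μ / 2)} ≤ ε / 2 := by
    refine (measure_sum_sq_lt_le hi hm hμ hμ0 Λ'
      (Finset.card_pos.1 (Nat.cast_pos.1 hn'))).trans ?_
    have h3 : 8 / (ε * μ ^ 2) ≤ n' := hM.trans hMn'
    rw [div_le_iff₀ (by positivity)] at h3 ⊢
    linarith
  have hmarkov := (mul_meas_ge_le_integral_of_nonneg (ae_of_all P hBad0) hBad_int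
    (T / 2 * (n' * (μ / 2)))).trans hEBad
  have hsecond : P.real {ω | T / 2 * (n' * (μ / 2)) ≤ Bad ω} ≤ ε / 2 := by
    refine le_of_mul_le_mul_left (hmarkov.trans ?_) (by positivity : 0 < T / 2 * (n' * (μ / 2)))
    have h3 : δ * (8 * 2 ^ d * (G + 1)) = ε * μ := by
      simp only [δ]
      field_simp
    calc δ * T * n * G ≤ δ * T * (2 ^ d * n') * (G + 1) := by
          gcongr
          linarith
      _ = T * n' / 8 * (δ * (8 * 2 ^ d * (G + 1))) := by ring
      _ = T / 2 * (n' * (μ / 2)) * (ε / 2) := by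
          rw [h3]
          ring
  linarith

end CentredGain

end RandomInterface

end

theorem theorem1p3 {Ω : Type*} [MeasurableSpace Ω] (P : Measure Ω) [IsProbabilityMeasure P]
    (d : ℕ)
    (ξ : (Fin d → ℤ) → Ω → ℝ)
    (hξ_meas : ∀ x, Measurable (ξ x))
    (hξ_indep : iIndepFun ξ P)
    (hξ_ident : ∀ x, IdentDistrib (ξ x) (ξ 0) P P)
    (hξ_sq : MemLp (ξ 0) 2 P)
    (hξ_ne : ∫ ω, (ξ 0 ω) ^ 2 ∂P ≠ 0)
    (V : ℝ → ℝ) (hV : ContDiff ℝ 2 V) (hV_even : ∀ s, V (-s) = V s)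
    (A B C₂ : ℝ) (hA : 0 < A) (hV_growth : ∀ s, A * s ^ 2 - B ≤ V s)
    (hC₂ : 0 < C₂) (hV_second : ∀ s, deriv (deriv V) s ≤ C₂)
    (hd : d = 1 ∨ d = 2 ∨ (3 ≤ d ∧ ∫ ω, ξ 0 ω ∂P ≠ 0)) :
    ∀ u : Fin d → ℝ, ∀ᵐ ω ∂P,
      ¬ ∃ σ : ℝ, RandomInterface.IsSurfaceTension V (fun x => ξ x ω) u σ := by
  intro u
  have hd0 : 0 < d := by omega
  obtain ⟨κ, hκ, hσ⟩ := RandomInterface.exists_card_mul_surfaceTension_le ⟨0, hd0⟩ hV hV_even hA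
    hV_growth hC₂ hV_second u
  refine RandomInterface.ae_not_isSurfaceTension V ξ u fun K ε hε => ?_
  by_cases hmean : ∫ ω, ξ 0 ω ∂P = 0
  · have hd2 : d = 1 ∨ d = 2 := by
      rcases hd with h | h | h
      · exact Or.inl h
      · exact Or.inr h
      · exact absurd hmean h.2
    exact RandomInterface.measure_surfaceTension_ge_of_mean_eq_zero hd2 hξ_indep hξ_meas hξ_ident
      hξ_sq hmean hξ_ne hκ hC₂ u hσ K hε
  · exact RandomInterface.measure_surfaceTension_ge_of_mean_ne_zero hd0 hξ_indep hξ_meas hξ_ident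
      hξ_sq hmean hκ hC₂ u hσ K hε
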